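/- Let $k$ be a field and $V$ a $k$-vector space. Two subspaces $A,B\subseteq V$ are commensurable, $A\sim B$, if $(A+B)/(A\cap B)$ is finite dimensional. For a subspace $A$ of a $k$-vector space $U$ let $\mathrm{GL}(U,A)=\{\sigma\in\mathrm{Aut}_k(U):\sigma A\sim A\}$, and for $\sigma\in\mathrm{GL}(U,A)$ let $$i(\sigma,A,U)=\dim_k A/(A\cap\sigma A)-\dim_k \sigma A/(A\cap\sigma A).$$ For commensurable $A,B$ let $(A\mid B)$ be the relative determinant line, canonically $\Lambda^{\max}(A/N)\otimes\Lambda^{\max}(B/N)^{*}$ for every $N\subseteq A\cap B$ of finite codimension in $A$ and in $B$. The pairs $(\sigma,s)$ with $\sigma\in\mathrm{GL}(U,A)$ and $0\neq s\in(A\mid\sigma A)$ form, with the product $(\sigma,s)(\tau,t)=(\sigma\tau,\,s\cdot\sigma(t))$, a central extension of $\mathrm{GL}(U,A)$ by $k^\times$. For commuting $\sigma,\tau\in \mathrm{GL}(U,A)$ let $\{\sigma,\tau\}^U_A=\tilde\sigma\tilde\tau\tilde\sigma^{-1}\tilde\tau^{-1}\in k^\times$ be the commutator of arbitrary lifts to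 this extension, and define the tame symbol $$\langle\sigma,\tau\rangle^U_A=(-1)^{i(\sigma,A,U)\,i(\tau,A,U)}\{\sigma,\tau\}^U_A\in k^\times .$$ Let $\{V_i\}_{i\in I}$ and $\{W_i\}_{i\in I}$ be families of subspaces of $V$ with $V_i\subseteq W_i$ for all $i$. Let $\mathrm{GL}(V,\{V_i\}_{i\in I})$ be the group of all $\sigma\in\mathrm{Aut}_k(V)$ such that $\sigma\in\mathrm{GL}(V,V_i)$ for all $i$ and $\sigma V_i=V_i$ for all but finitely many $i$. Let $\sigma,\tau\in\mathrm{GL}(V,\{V_i\}_{i\in I})$ be commuting elements with $\sigma W_i=W_i$ and $\tau W_i=W_i$ for all $i$ (for instance, any commuting elements if every $W_i$ is stable under the whole group $\mathrm{GL}(V,\{V_i\}_{i\in I})$). Put $A_I=\prod_{i\in I}V_i\subseteq W_I=\prod_{i\in I}W_i$, and let $\sigma,\tau$ act on each $W_i$ by restriction and on $W_I$ diagonally; these actions lie in $\mathrm{GL}(W_i,V_i)$ and in $\mathrm{GL}(W_I,A_I)$. Then $\langle\sigma,\tau\rangle^{W_i}_{V_i}\ne 1$ for only finitely many $i$, and $$\langle\sigma,\tau\rangle^{W_I}_{A_I}=\prod_{i\in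 I}\langle\sigma,\tau\rangle^{W_i}_{V_i}.$$ Accordingly, if $\{\sigma,\tau\}^{W_I}_{A_I}=1$ and $i(\sigma,A_I,W_I)=0$, then $\prod_{i\in I}\langle\sigma,\tau\rangle^{W_i}_{V_i}=1$. -/

import Mathlib

namespace Tame

open Submodule

variable {k V : Type*} [Field k] [AddCommGroup V] [Module k V]

/-- Two subspaces `A`, `B` are commensurable if `(A + B) / (A ∩ B)` is finite dimensional. -/
def Commensurable (A B : Submodule k V) : Prop :=
  FiniteDimensional k (↥(A ⊔ B) ⧸ (A ⊓ B).submoduleOf (A ⊔ B))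

/-- Auxiliary: `(A + B) / B` is finite dimensional, see `finOver_iff_quotient`. -/
def FinOver (A B : Submodule k V) : Prop := ∃ F : Submodule k V, F.FG ∧ A ≤ B ⊔ F

theorem finOver_of_le {A B : Submodule k V} (h : A ≤ B) : FinOver A B :=
  ⟨⊥, fg_bot, by simpa using h⟩

theorem FinOver.trans {A B C : Submodule k V} (h : FinOver A B) (h' : FinOver B C) :
    FinOver A C := by
  obtain ⟨F, hF, h⟩ := h
  obtain ⟨G, hG, h'⟩ := h'
  exact ⟨G ⊔ F, hG.sup hF, h.trans (by rw [← sup_assoc]; exact sup_le_sup_right h' _)⟩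

theorem FinOver.map {V' : Type*} [AddCommGroup V'] [Module k V'] {A B : Submodule k V}
    (h : FinOver A B) (f : V →ₗ[k] V') : FinOver (A.map f) (B.map f) := by
  obtain ⟨F, hF, h⟩ := h
  exact ⟨F.map f, hF.map f, by rw [← Submodule.map_sup]; exact Submodule.map_mono h⟩

theorem finOver_iff_map {A B : Submodule k V} :
    FinOver A B ↔ FiniteDimensional k (A.map B.mkQ) := by
  constructor
  · rintro ⟨F, hF, h⟩
    have hF' : FiniteDimensional k (F.map B.mkQ) := Module.Finite.iff_fg.2 (hF.map _)
    have hle : A.map B.mkQ ≤ F.map B.mkQ := by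
      rintro _ ⟨a, ha, rfl⟩
      obtain ⟨b, hb, f, hf, rfl⟩ := Submodule.mem_sup.1 (h ha)
      exact ⟨f, hf, by simp [(Submodule.Quotient.mk_eq_zero B).2 hb]⟩
    exact Submodule.finiteDimensional_of_le hle
  · intro h
    obtain ⟨s, hs⟩ := Module.Finite.iff_fg.1 h
    have hs' : ∀ q : (V ⧸ B), ∃ v, B.mkQ v = q := B.mkQ_surjective
    choose r hr using hs'
    classical
    refine ⟨span k (s.image r), ⟨_, rfl⟩, ?_⟩
    suffices h : A.map B.mkQ ≤ (span k ↑(s.image r)).map B.mkQ by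
      rw [Submodule.map_le_iff_le_comap, Submodule.comap_map_eq, Submodule.ker_mkQ, sup_comm] at h
      exact h
    rw [← hs, Submodule.map_span, Submodule.span_le]
    intro q hq
    exact Submodule.subset_span ⟨r q, by simpa using ⟨q, hq, rfl⟩, hr q⟩

theorem finOver_iff_quotient {A B : Submodule k V} :
    FinOver A B ↔ FiniteDimensional k (A ⧸ B.submoduleOf A) := by
  rw [finOver_iff_map]
  have hk : LinearMap.ker (B.mkQ ∘ₗ A.subtype) = B.submoduleOf A := by
    ext x; simp [Submodule.submoduleOf]
  have e := (Submodule.quotEquivOfEq _ _ hk).symm.trans (B.mkQ ∘ₗ A.subtype).quotKerEquivRange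
  rw [LinearMap.range_comp, Submodule.range_subtype] at e
  exact ⟨fun h => Module.Finite.equiv e.symm, fun h => Module.Finite.equiv e⟩

theorem FinOver.inf {A B C : Submodule k V} (hB : FinOver A B) (hC : FinOver A C) :
    FinOver A (B ⊓ C) := by
  rw [finOver_iff_quotient] at *
  let f : (A ⧸ (B ⊓ C).submoduleOf A) →ₗ[k] (A ⧸ B.submoduleOf A) × (A ⧸ C.submoduleOf A) :=
    Submodule.liftQ _ ((B.submoduleOf A).mkQ.prod (C.submoduleOf A).mkQ) (by
      intro x hx
      rw [LinearMap.ker_prod, ker_mkQ, ker_mkQ]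
      exact hx)
  refine Module.Finite.of_injective f ?_
  rw [← LinearMap.ker_eq_bot, Submodule.ker_liftQ_eq_bot]
  intro x hx
  rw [LinearMap.ker_prod, ker_mkQ, ker_mkQ] at hx
  exact hx

theorem commensurable_iff {A B : Submodule k V} :
    Commensurable A B ↔ FinOver A B ∧ FinOver B A := by
  rw [Commensurable, ← finOver_iff_quotient]
  constructor
  · intro h
    exact ⟨((finOver_of_le le_sup_left).trans h).trans (finOver_of_le inf_le_right),
      ((finOver_of_le le_sup_right).trans h).trans (finOver_of_le inf_le_left)⟩
  · rintro ⟨h, h'⟩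
    have hA : FinOver A (A ⊓ B) := FinOver.inf (finOver_of_le le_rfl) h
    obtain ⟨F, hF, hBF⟩ := h'
    exact FinOver.trans ⟨F, hF, sup_le le_sup_left hBF⟩ hA

theorem Commensurable.refl (A : Submodule k V) : Commensurable A A :=
  commensurable_iff.2 ⟨finOver_of_le le_rfl, finOver_of_le le_rfl⟩

theorem Commensurable.symm {A B : Submodule k V} (h : Commensurable A B) : Commensurable B A :=
  commensurable_iff.2 (commensurable_iff.1 h).symm

theorem Commensurable.trans {A B C : Submodule k V} (h : Commensurable A B)
    (h' : Commensurable B C) : Commensurable A C := by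
  rw [commensurable_iff] at *
  exact ⟨h.1.trans h'.1, h'.2.trans h.2⟩

theorem Commensurable.map {V' : Type*} [AddCommGroup V'] [Module k V'] {A B : Submodule k V}
    (h : Commensurable A B) (f : V →ₗ[k] V') : Commensurable (A.map f) (B.map f) := by
  rw [commensurable_iff] at *
  exact ⟨h.1.map f, h.2.map f⟩

/-! ### Relative determinant lines -/

/-- The list `x` is a frame of `X` relative to `N`: one has `N ⊆ X` and the classes of the members of
`x` form a basis of `X / N`. -/
structure IsFrame (N X : Submodule k V) (x : List V) : Prop where
  sup_span : N ⊔ span k {v | v ∈ x} = X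
  linearIndependent : LinearIndependent k (fun i : Fin x.length => N.mkQ x[i])

theorem isFrame_nil {N X : Submodule k V} : IsFrame N X [] ↔ N = X := by
  constructor
  · rintro ⟨h, -⟩; simpa using h
  · rintro rfl; 
    exact ⟨by simp, @linearIndependent_empty_type (Fin 0) k _ _ _ _ _ _⟩

theorem IsFrame.le {N X : Submodule k V} {x : List V} (h : IsFrame N X x) : N ≤ X :=
  h.sup_span ▸ le_sup_left

theorem isFrame_cons {N X : Submodule k V} {v : V} {l : List V} :
    IsFrame N X (v :: l) ↔ v ∉ N ∧ IsFrame (N ⊔ span k {v}) X l := by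
  have hs : N ⊔ span k {w | w ∈ v :: l} = (N ⊔ span k {v}) ⊔ span k {w | w ∈ l} := by
    rw [sup_assoc, ← span_union]; congr 2; ext; simp
  have hl : LinearIndependent k (fun i : Fin (v :: l).length => N.mkQ (v :: l)[i]) ↔
      v ∉ N ∧ LinearIndependent k (fun i : Fin l.length => (N ⊔ span k {v}).mkQ l[i]) := by
    rw [Fintype.linearIndependent_iff, Fintype.linearIndependent_iff]
    simp only [← map_smul, ← map_sum]
    simp only [mkQ_apply, Quotient.mk_eq_zero]
    constructor
    · intro h
      constructor
      · intro hv
        have := h (Fin.cons 1 0) (by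
          erw [Fin.sum_univ_succ]; simpa using hv) 0
        simp at this
      · intro g hg i
        obtain ⟨n, hn, u, hu, e⟩ := Submodule.mem_sup.1 hg
        obtain ⟨a, rfl⟩ := Submodule.mem_span_singleton.1 hu
        have := h (Fin.cons (-a) g) (by
          erw [Fin.sum_univ_succ]
          simp only [Fin.cons_zero, Fin.cons_succ]
          have : n = -a • v + ∑ i, g i • l[i] := by rw [← e]; simp
          simpa [this] using hn) i.succ
        simpa using this
    · rintro ⟨hv, h⟩ g hg
      erw [Fin.sum_univ_succ] at hg
      have h1 : ∀ i : Fin l.length, g i.succ = 0 := by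
        apply h
        have e : ∑ i : Fin l.length, g i.succ • l[i]
          = (g 0 • v + ∑ i : Fin l.length, g i.succ • l[i]) + (- g 0) • v := by simp
        rw [e]
        exact Submodule.add_mem_sup (by simpa using hg)
          (Submodule.smul_mem _ _ (mem_span_singleton_self v))
      have h0 : g 0 = 0 := by
        by_contra hne
        apply hv
        have : g 0 • v ∈ N := by
          simp only [h1, zero_smul, Finset.sum_const_zero, add_zero] at hg
          exact hg
        exact (Submodule.smul_mem_iff _ hne).1 this
      intro i
      refine Fin.cases h0 h1 i
  constructor
  · rintro ⟨h1, h2⟩; exact ⟨(hl.1 h2).1, hs ▸ h1, (hl.1 h2).2⟩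
  · rintro ⟨h1, h2, h3⟩; exact ⟨hs ▸ h2, hl.2 ⟨h1, h3⟩⟩

theorem IsFrame.append {M N X : Submodule k V} {w x : List V} (hw : IsFrame M N w)
    (hx : IsFrame N X x) : IsFrame M X (w ++ x) := by
  induction w generalizing M with
  | nil => rw [isFrame_nil] at hw; subst hw; simpa using hx
  | cons v l ih =>
    rw [isFrame_cons] at hw
    rw [List.cons_append, isFrame_cons]
    exact ⟨hw.1, ih hw.2⟩

theorem IsFrame.finOver {N X : Submodule k V} {x : List V} (h : IsFrame N X x) : FinOver X N :=
  ⟨span k {v | v ∈ x}, Submodule.fg_span (List.finite_toSet x), h.sup_span.ge⟩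

theorem exists_isFrame {N X : Submodule k V} (h : N ≤ X) (hf : FinOver X N) :
    ∃ x, IsFrame N X x := by
  rw [finOver_iff_map] at hf
  let b := Module.finBasis k (X.map N.mkQ)
  have hb : ∀ i, ∃ v ∈ X, N.mkQ v = b i := fun i => (b i).2
  choose r hr hr' using hb
  refine ⟨List.ofFn r, ?_, ?_⟩
  · have : {v | v ∈ List.ofFn r} = Set.range r := by ext; simp [List.mem_ofFn]
    rw [this]
    apply le_antisymm
    · exact sup_le h (span_le.2 (by rintro _ ⟨i, rfl⟩; exact hr i))
    · suffices h : X.map N.mkQ ≤ (span k (Set.range r)).map N.mkQ by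
        rw [Submodule.map_le_iff_le_comap, Submodule.comap_map_eq, Submodule.ker_mkQ, sup_comm] at h
        exact h
      rw [Submodule.map_span, ← Set.range_comp]
      have : (N.mkQ ∘ r) = fun i => (X.map N.mkQ).subtype (b i) := by ext i; exact hr' i
      rw [this, Set.range_comp', ← Submodule.map_span, b.span_eq]
      simp
  · have hli : LinearIndependent k (fun i => N.mkQ (r i)) := by
      have : (fun i => N.mkQ (r i)) = fun i => (X.map N.mkQ).subtype (b i) := by ext i; exact hr' i
      rw [this]
      exact b.linearIndependent.map' _ (ker_subtype _)
    have := hli.comp (Fin.cast (List.length_ofFn (f := r))) (Fin.cast_injective _)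
    convert this using 2 with i
    simp only [Fin.getElem_fin, List.getElem_ofFn, Function.comp_apply]
    rfl

/-- The wedge product, in the exterior algebra of `V / N`, of the classes of the members of `x`. If `x`
is a frame of `X` relative to `N`, it is a generator of the line `Λ^max (X / N)`. -/
noncomputable def wedge (N : Submodule k V) (x : List V) : ExteriorAlgebra k (V ⧸ N) :=
  (x.map fun v => ExteriorAlgebra.ι k (N.mkQ v)).prod

theorem wedge_append (N : Submodule k V) (x y : List V) :
    wedge N (x ++ y) = wedge N x * wedge N y := by simp [wedge]

theorem wedge_eq_ιMulti (N : Submodule k V) (x : List V) :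
    wedge N x = ExteriorAlgebra.ιMulti k x.length (fun i => N.mkQ x[i]) := by
  rw [ExteriorAlgebra.ιMulti_apply, wedge]
  congr 1
  apply List.ext_getElem <;> simp

theorem wedge_ne_zero {N : Submodule k V} {x : List V} 
    (h : LinearIndependent k (fun i : Fin x.length => N.mkQ x[i])) : wedge N x ≠ 0 := by
  intro h0
  rw [wedge_eq_ιMulti] at h0
  obtain ⟨π, hπ⟩ : ∃ π : (V ⧸ N) →ₗ[k] (Fin x.length → k), ∀ i, π (N.mkQ x[i]) = Pi.single i 1 := by
    let U := span k (Set.range (fun i : Fin x.length => N.mkQ x[i]))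
    let b := Module.Basis.span h
    obtain ⟨π, hπ⟩ := LinearMap.exists_extend (b.equivFun : U →ₗ[k] (Fin x.length → k))
    refine ⟨π, fun i => ?_⟩
    have h1 : N.mkQ x[i] = U.subtype (b i) := (congrArg Subtype.val (Module.Basis.span_apply h i)).symm
    rw [h1]
    have := LinearMap.congr_fun hπ (b i)
    simp only [LinearMap.comp_apply] at this
    rw [this]
    ext j
    rw [LinearEquiv.coe_coe, Module.Basis.equivFun_self, Pi.single_apply]
    simp [eq_comm]
  let f : (V ⧸ N) [⋀^Fin x.length]→ₗ[k] k := (Matrix.detRowAlternating).compLinearMap π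
  have h1 := congrArg (ExteriorAlgebra.liftAlternating (R := k) (Pi.single x.length f)) h0
  rw [ExteriorAlgebra.liftAlternating_apply_ιMulti] at h1
  simp only [Pi.single_eq_same, map_zero, f, AlternatingMap.compLinearMap_apply] at h1
  have : (fun i => π (N.mkQ x[i])) = (1 : Matrix (Fin x.length) (Fin x.length) k) := by
    ext i j; rw [hπ]; simp [Matrix.one_apply, Pi.single_apply, eq_comm]
  erw [this] at h1
  change Matrix.det 1 = 0 at h1
  rw [Matrix.det_one] at h1
  exact one_ne_zero h1

theorem IsFrame.exists_ratio {N X : Submodule k V} {x y : List V} (hx : IsFrame N X x)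
    (hy : IsFrame N X y) : ∃ α : kˣ, wedge N y = α • wedge N x := by
  have key : ∀ {x : List V} (hx : IsFrame N X x),
      ∃ b : Module.Basis (Fin x.length) k (X.map N.mkQ), ∀ i, (b i : V ⧸ N) = N.mkQ x[i] := by
    intro x hx
    have hU : span k (Set.range (fun i : Fin x.length => N.mkQ x[i])) = X.map N.mkQ := by
      rw [← hx.sup_span, Submodule.map_sup, Submodule.map_span, N.mkQ_map_self, bot_sup_eq]
      congr 1
      ext q
      simp only [Set.mem_range, Set.mem_image]
      constructor
      · rintro ⟨i, rfl⟩; exact ⟨_, List.getElem_mem _, rfl⟩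
      · rintro ⟨v, hv, rfl⟩
        obtain ⟨i, hi, rfl⟩ := List.getElem_of_mem hv
        exact ⟨⟨i, hi⟩, rfl⟩
    refine ⟨(Module.Basis.span hx.linearIndependent).map (LinearEquiv.ofEq _ _ hU), fun i => ?_⟩
    exact congrArg Subtype.val (Module.Basis.span_apply hx.linearIndependent i)
  obtain ⟨b, hb⟩ := key hx
  obtain ⟨c, hc⟩ := key hy
  have : FiniteDimensional k (X.map N.mkQ) := b.finiteDimensional_of_finite
  have e1 := Module.finrank_eq_card_basis b
  have e2 := Module.finrank_eq_card_basis c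
  have wx : ∀ (x : List V) (c : Module.Basis (Fin x.length) k (X.map N.mkQ))
      (hc : ∀ i, (c i : V ⧸ N) = N.mkQ x[i]), 
      wedge N x = (exteriorPower.map x.length (X.map N.mkQ).subtype
        (exteriorPower.ιMulti k x.length c) : ExteriorAlgebra k (V ⧸ N)) := by
    intro x c hc
    rw [wedge_eq_ιMulti, exteriorPower.map_apply_ιMulti, exteriorPower.ιMulti_apply_coe]
    congr 1; ext i; exact (hc i).symm
  have hlen : y.length = x.length := by simpa using e2.symm.trans e1
  have hfr : Module.finrank k (⋀[k]^(x.length) (X.map N.mkQ)) = 1 := by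
    rw [exteriorPower.finrank_eq, e1]; simp
  have hxne : exteriorPower.ιMulti k x.length b ≠ 0 := by
    intro h
    apply wedge_ne_zero hx.linearIndependent
    rw [wx x b hb, h]; simp
  have hyw : ∃ z : ⋀[k]^(x.length) (X.map N.mkQ), wedge N y =
      (exteriorPower.map x.length (X.map N.mkQ).subtype z : ExteriorAlgebra k (V ⧸ N)) := by
    rw [← hlen]; exact ⟨_, wx y c hc⟩
  obtain ⟨z, hz⟩ := hyw
  obtain ⟨a, rfl⟩ := (finrank_eq_one_iff_of_nonzero' _ hxne).1 hfr z
  have ha : a ≠ 0 := by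
    rintro rfl
    exact wedge_ne_zero hy.linearIndependent (by rw [hz]; simp)
  refine ⟨Units.mk0 a ha, ?_⟩
  rw [hz, wx x b hb]; simp [Units.smul_def]

theorem IsFrame.ratio_unique {N X : Submodule k V} {x : List V} (hx : IsFrame N X x)
    {α β : kˣ} (h : α • wedge N x = β • wedge N x) : α = β := by
  have : ((α : k) - β) • wedge N x = 0 := by
    rw [sub_smul]; exact sub_eq_zero.2 h
  rcases smul_eq_zero.1 this with h | h
  · exact Units.ext (sub_eq_zero.1 h)
  · exact absurd h (wedge_ne_zero hx.linearIndependent)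

theorem wedge_mul_ι_eq_zero {M N : Submodule k V} {w : List V} (hw : IsFrame M N w) (l : List V)
    {n : V} (hn : n ∈ N) : wedge M w * wedge M l * ExteriorAlgebra.ι k (M.mkQ n) = 0 := by
  rw [← hw.sup_span] at hn
  obtain ⟨m, hm, u, hu, rfl⟩ := Submodule.mem_sup.1 hn
  have h0 : M.mkQ m = 0 := by simpa using hm
  rw [map_add, h0, zero_add]
  clear hn
  induction hu using Submodule.span_induction with
  | mem v hv =>
    have e : wedge M w * wedge M l * ExteriorAlgebra.ι k (M.mkQ v) = wedge M (w ++ l ++ [v]) := by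
      rw [wedge_append, wedge_append]; simp [wedge]
    rw [e, wedge_eq_ιMulti]
    apply ExteriorAlgebra.ιMulti_eq_zero_of_not_inj
    obtain ⟨i, hi, rfl⟩ := List.getElem_of_mem hv
    intro hinj
    have := @hinj ⟨i, by simp; omega⟩ ⟨(w ++ l).length, by simp⟩ (by
      simp [hi])
    simp at this
    omega
  | zero => simp
  | add a b _ _ ha hb =>
    rw [map_add, map_add, mul_add, ha, hb, add_zero]
  | smul a b _ hb => rw [map_smul, map_smul, mul_smul_comm, hb, smul_zero]

theorem wedge_prepend {M N : Submodule k V} {w x y : List V} (hw : IsFrame M N w) {α : kˣ}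
    (h : wedge N x = α • wedge N y) : wedge M (w ++ x) = α • wedge M (w ++ y) := by
  obtain ⟨r, hr⟩ := N.mkQ.exists_rightInverse_of_surjective (range_mkQ N)
  have key : ∀ x : List V, wedge M w * ExteriorAlgebra.map (M.mkQ ∘ₗ r) (wedge N x) =
      wedge M w * wedge M x := by
    intro x
    induction x using List.reverseRecOn with
    | nil => simp [wedge]
    | append_singleton l v ih =>
      have hv : r (N.mkQ v) - v ∈ N := by
        rw [← Submodule.Quotient.mk_eq_zero, ← mkQ_apply, map_sub, ← LinearMap.comp_apply, hr]
        simp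
      have e : ∀ (P : Submodule k V), wedge P [v] = ExteriorAlgebra.ι k (P.mkQ v) := by
        intro P; simp [wedge]
      rw [wedge_append, wedge_append, map_mul, ← mul_assoc, ih, ← mul_assoc, e, e,
        ExteriorAlgebra.map_apply_ι, LinearMap.comp_apply,
        show r (N.mkQ v) = v + (r (N.mkQ v) - v) by abel, map_add, map_add, mul_add,
        wedge_mul_ι_eq_zero hw l hv, add_zero]
  rw [wedge_append, wedge_append, ← key, h, ← key y]
  simp [Units.smul_def]

/-- A nonzero element of the relative determinant line `(X | Y)` of two commensurable subspaces, that
is a coherent choice, for `N` of finite codimension in both `X` and `Y`, of a nonzero element of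
`Λ^max (X / N) ⊗ Λ^max (Y / N)^*`. It is recorded by its coordinates: for frames `x` of `X` and `y`
of `Y` relative to the same `N`, the element is
`coeff x y • (wedge N x ⊗ (wedge N y)^*)`, or, as an isomorphism `Λ^max (Y / N) → Λ^max (X / N)`, it
sends `wedge N y` to `coeff x y • wedge N x`. The field `basis_change` says that this element does
not depend on the frames, and `shrink` that it is compatible with the canonical isomorphisms
`Λ^max (X / M) = Λ^max (N / M) ⊗ Λ^max (X / N)` for `M ⊆ N`. -/
structure DetIso (X Y : Submodule k V) where
  coeff : ∀ {N : Submodule k V} {x y : List V}, IsFrame N X x → IsFrame N Y y → kˣ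
  basis_change : ∀ {N : Submodule k V} {x x' y y' : List V} (hx : IsFrame N X x)
    (hx' : IsFrame N X x') (hy : IsFrame N Y y) (hy' : IsFrame N Y y') (α β : kˣ),
    wedge N x' = α • wedge N x → wedge N y' = β • wedge N y →
      α * coeff hx' hy' = β * coeff hx hy
  shrink : ∀ {M N : Submodule k V} {w x y : List V} (hw : IsFrame M N w) (hx : IsFrame N X x)
    (hy : IsFrame N Y y), coeff (hw.append hx) (hw.append hy) = coeff hx hy

theorem exists_common {X N₀ N₁ : Submodule k V} {x₀ x₁ : List V}
    (hx₀ : IsFrame N₀ X x₀) (hx₁ : IsFrame N₁ X x₁) :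
    ∃ M w₀ w₁, IsFrame M N₀ w₀ ∧ IsFrame M N₁ w₁ := by
  have h : FinOver X (N₀ ⊓ N₁) := hx₀.finOver.inf hx₁.finOver
  obtain ⟨w₀, h₀⟩ := exists_isFrame inf_le_left ((finOver_of_le hx₀.le).trans h)
  obtain ⟨w₁, h₁⟩ := exists_isFrame inf_le_right ((finOver_of_le hx₁.le).trans h)
  exact ⟨_, w₀, w₁, h₀, h₁⟩

theorem DetIso.ext_of_coeff {X Y : Submodule k V} {c d : DetIso X Y} {N : Submodule k V}
    {x y : List V} (hx : IsFrame N X x) (hy : IsFrame N Y y)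
    (h : c.coeff hx hy = d.coeff hx hy) : c = d := by
  have key : ∀ {N₁ : Submodule k V} {x₁ y₁ : List V} (hx₁ : IsFrame N₁ X x₁)
      (hy₁ : IsFrame N₁ Y y₁), c.coeff hx₁ hy₁ = d.coeff hx₁ hy₁ := by
    intro N₁ x₁ y₁ hx₁ hy₁
    obtain ⟨M, w, w₁, hw, hw₁⟩ := exists_common hx hx₁
    obtain ⟨α, hα⟩ := (hw.append hx).exists_ratio (hw₁.append hx₁)
    obtain ⟨β, hβ⟩ := (hw.append hy).exists_ratio (hw₁.append hy₁)
    have e1 := c.basis_change (hw.append hx) (hw₁.append hx₁) (hw.append hy) (hw₁.append hy₁) α β hα hβ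
    have e2 := d.basis_change (hw.append hx) (hw₁.append hx₁) (hw.append hy) (hw₁.append hy₁) α β hα hβ
    rw [c.shrink hw₁ hx₁ hy₁, c.shrink hw hx hy, h] at e1
    rw [d.shrink hw₁ hx₁ hy₁, d.shrink hw hx hy, ← e1] at e2
    exact (mul_left_cancel e2).symm
  cases c; cases d
  congr
  funext N x y hx hy
  exact key hx hy

/-- Auxiliary: the value `s` on the frames `x`, `y` relative to `N` that is forced by the value `r` on
the frames `x₀`, `y₀` relative to `N₀`. -/
def CoeffRel {N₀ N : Submodule k V} (x₀ y₀ x y : List V) (r s : kˣ) : Prop :=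
  ∃ (M : Submodule k V) (w₀ w : List V) (α β : kˣ), IsFrame M N₀ w₀ ∧ IsFrame M N w ∧
    wedge M (w ++ x) = α • wedge M (w₀ ++ x₀) ∧ wedge M (w ++ y) = β • wedge M (w₀ ++ y₀) ∧
    α * s = β * r

theorem CoeffRel.unique {X Y N₀ N : Submodule k V} {x₀ y₀ x y : List V} {r s t : kˣ}
    (hx₀ : IsFrame N₀ X x₀) (hy₀ : IsFrame N₀ Y y₀)
    (h : CoeffRel (N₀ := N₀) (N := N) x₀ y₀ x y r s)
    (h' : CoeffRel (N₀ := N₀) (N := N) x₀ y₀ x y r t) : s = t := by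
  obtain ⟨M, w₀, w, α, β, hw₀, hw, e1, e2, e3⟩ := h
  obtain ⟨M', w₀', w', α', β', hw₀', hw', e1', e2', e3'⟩ := h'
  obtain ⟨P, u, u', hu, hu'⟩ := exists_common hw hw'
  replace e1 := wedge_prepend hu e1
  replace e2 := wedge_prepend hu e2
  replace e1' := wedge_prepend hu' e1'
  replace e2' := wedge_prepend hu' e2'
  rw [← List.append_assoc, ← List.append_assoc] at e1 e2 e1' e2'
  obtain ⟨γ, hγ⟩ := (hu.append hw).exists_ratio (hu'.append hw')
  obtain ⟨δ, hδ⟩ := (hu.append hw₀).exists_ratio (hu'.append hw₀')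
  have f1 : α' * δ = γ * α := by
    apply ((hu.append hw₀).append hx₀).ratio_unique
    rw [mul_smul, mul_smul, ← e1, wedge_append P (u ++ w₀), ← smul_mul_assoc, ← hδ, ← wedge_append,
      ← e1', wedge_append, hγ, wedge_append P (u ++ w), smul_mul_assoc]
  have f2 : β' * δ = γ * β := by
    apply ((hu.append hw₀).append hy₀).ratio_unique
    rw [mul_smul, mul_smul, ← e2, wedge_append P (u ++ w₀), ← smul_mul_assoc, ← hδ, ← wedge_append,
      ← e2', wedge_append, hγ, wedge_append P (u ++ w), smul_mul_assoc]
  have h1 : s = α⁻¹ * β * r := by rw [mul_assoc, ← e3]; group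
  have h2 : t = α'⁻¹ * β' * r := by rw [mul_assoc, ← e3']; group
  rw [h1, h2]
  have f1' : α' = γ * α * δ⁻¹ := by rw [← f1]; group
  have f2' : β' = γ * β * δ⁻¹ := by rw [← f2]; group
  rw [f1', f2']
  congr 1
  rw [mul_inv, mul_inv, inv_inv]
  calc α⁻¹ * β = (γ⁻¹ * γ) * (δ * δ⁻¹) * (α⁻¹ * β) := by simp
    _ = _ := by ac_rfl

theorem CoeffRel.exists {X Y N₀ N : Submodule k V} {x₀ y₀ x y : List V} (r : kˣ)
    (hx₀ : IsFrame N₀ X x₀) (hy₀ : IsFrame N₀ Y y₀) (hx : IsFrame N X x) (hy : IsFrame N Y y) :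
    ∃ s, CoeffRel (N₀ := N₀) (N := N) x₀ y₀ x y r s := by
  obtain ⟨M, w₀, w, hw₀, hw⟩ := exists_common hx₀ hx
  obtain ⟨α, hα⟩ := (hw₀.append hx₀).exists_ratio (hw.append hx)
  obtain ⟨β, hβ⟩ := (hw₀.append hy₀).exists_ratio (hw.append hy)
  exact ⟨α⁻¹ * (β * r), M, w₀, w, α, β, hw₀, hw, hα, hβ, by simp⟩

theorem exists_detIso {X Y N₀ : Submodule k V} {x₀ y₀ : List V}
    (hx₀ : IsFrame N₀ X x₀) (hy₀ : IsFrame N₀ Y y₀) (r : kˣ) :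
    ∃ c : DetIso X Y, c.coeff hx₀ hy₀ = r := by
  let f : ∀ {N : Submodule k V} {x y : List V}, IsFrame N X x → IsFrame N Y y → kˣ :=
    fun hx hy => (CoeffRel.exists r hx₀ hy₀ hx hy).choose
  have hf : ∀ {N : Submodule k V} {x y : List V} (hx : IsFrame N X x) (hy : IsFrame N Y y),
    CoeffRel (N₀ := N₀) (N := N) x₀ y₀ x y r (f hx hy) :=
      fun hx hy => (CoeffRel.exists r hx₀ hy₀ hx hy).choose_spec
  refine ⟨⟨f, ?_, ?_⟩, ?_⟩
  · intro N x x' y y' hx hx' hy hy' α β hα hβ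
    obtain ⟨M, w₀, w, α₁, β₁, hw₀, hw, e1, e2, e3⟩ := hf hx hy
    have : f hx' hy' = α⁻¹ * (β * f hx hy) := by
      refine CoeffRel.unique hx₀ hy₀ (hf hx' hy')
        ⟨M, w₀, w, α * α₁, β * β₁, hw₀, hw, ?_, ?_, ?_⟩
      · rw [wedge_prepend hw hα, e1, mul_smul]
      · rw [wedge_prepend hw hβ, e2, mul_smul]
      · calc α * α₁ * (α⁻¹ * (β * f hx hy)) = (α * α⁻¹) * β * (α₁ * f hx hy) := by ac_rfl
          _ = β * β₁ * r := by rw [e3]; simp [mul_assoc]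
    rw [this]; simp
  · intro M N w x y hw hx hy
    obtain ⟨P, w₀, w', α₁, β₁, hw₀, hw', e1, e2, e3⟩ := hf (hw.append hx) (hw.append hy)
    exact CoeffRel.unique hx₀ hy₀ ⟨P, w₀, w' ++ w, α₁, β₁, hw₀, hw'.append hw,
      by simpa using e1, by simpa using e2, e3⟩ (hf hx hy)
  · exact CoeffRel.unique hx₀ hy₀ (hf hx₀ hy₀) ⟨N₀, [], [], 1, 1, isFrame_nil.2 rfl,
      isFrame_nil.2 rfl, by simp, by simp, by simp⟩

theorem DetIso.exists_comp {X Y Z : Submodule k V} (hXY : Commensurable X Y)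
    (hYZ : Commensurable Y Z) (c : DetIso X Y) (d : DetIso Y Z) :
    ∃ e : DetIso X Z, ∀ {N : Submodule k V} {x y z : List V} (hx : IsFrame N X x)
      (hy : IsFrame N Y y) (hz : IsFrame N Z z),
      e.coeff hx hz = c.coeff hx hy * d.coeff hy hz := by
  have hXY' := commensurable_iff.1 hXY
  have hYZ' := commensurable_iff.1 hYZ
  have h : FinOver X (X ⊓ Y ⊓ Z) :=
    ((finOver_of_le le_rfl).inf hXY'.1).inf (hXY'.1.trans hYZ'.1)
  obtain ⟨x₀, hx₀⟩ := exists_isFrame (inf_le_left.trans inf_le_left) h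
  obtain ⟨y₀, hy₀⟩ := exists_isFrame (inf_le_left.trans inf_le_right) (hXY'.2.trans h)
  obtain ⟨z₀, hz₀⟩ := exists_isFrame inf_le_right (hYZ'.2.trans (hXY'.2.trans h))
  obtain ⟨e, he⟩ := exists_detIso hx₀ hz₀ (c.coeff hx₀ hy₀ * d.coeff hy₀ hz₀)
  refine ⟨e, fun {N x y z} hx hy hz => ?_⟩
  obtain ⟨M, w, w₁, hw, hw₁⟩ := exists_common hx₀ hx
  obtain ⟨α, hα⟩ := (hw.append hx₀).exists_ratio (hw₁.append hx)
  obtain ⟨β, hβ⟩ := (hw.append hy₀).exists_ratio (hw₁.append hy)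
  obtain ⟨γ, hγ⟩ := (hw.append hz₀).exists_ratio (hw₁.append hz)
  have e1 := c.basis_change (hw.append hx₀) (hw₁.append hx) (hw.append hy₀) (hw₁.append hy) α β hα hβ
  have e2 := d.basis_change (hw.append hy₀) (hw₁.append hy) (hw.append hz₀) (hw₁.append hz) β γ hβ hγ
  have e3 := e.basis_change (hw.append hx₀) (hw₁.append hx) (hw.append hz₀) (hw₁.append hz) α γ hα hγ
  rw [c.shrink hw₁ hx hy, c.shrink hw hx₀ hy₀] at e1
  rw [d.shrink hw₁ hy hz, d.shrink hw hy₀ hz₀] at e2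
  rw [e.shrink hw₁ hx hz, e.shrink hw hx₀ hz₀, he] at e3
  apply mul_left_cancel (a := α)
  apply mul_left_cancel (a := β)
  calc β * (α * e.coeff hx hz) = (β * c.coeff hx₀ hy₀) * (γ * d.coeff hy₀ hz₀) := by
        rw [e3]; ac_rfl
    _ = _ := by rw [← e1, ← e2]; ac_rfl

theorem IsFrame.map {N X : Submodule k V} {x : List V} (σ : V ≃ₗ[k] V) (h : IsFrame N X x) :
    IsFrame (N.map (σ : V →ₗ[k] V)) (X.map (σ : V →ₗ[k] V)) (x.map σ) := by
  induction x generalizing N with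
  | nil => rw [isFrame_nil] at h; subst h; exact isFrame_nil.2 rfl
  | cons v l ih =>
    rw [isFrame_cons] at h
    rw [List.map_cons, isFrame_cons]
    refine ⟨?_, ?_⟩
    · rintro ⟨n, hn, e⟩
      exact h.1 (σ.injective e ▸ hn)
    · have := ih h.2
      rwa [Submodule.map_sup, Submodule.map_span, Set.image_singleton] at this

theorem wedge_map {N : Submodule k V} {x y : List V} {α : kˣ} (σ : V ≃ₗ[k] V)
    (h : wedge N x = α • wedge N y) :
    wedge (N.map (σ : V →ₗ[k] V)) (x.map σ) = α • wedge (N.map (σ : V →ₗ[k] V)) (y.map σ) := by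
  let f : (V ⧸ N) →ₗ[k] V ⧸ (N.map (σ : V →ₗ[k] V)) :=
    N.mapQ _ (σ : V →ₗ[k] V) (Submodule.le_comap_map _ _)
  have key : ∀ x : List V, wedge (N.map (σ : V →ₗ[k] V)) (x.map σ) =
      ExteriorAlgebra.map f (wedge N x) := by
    intro x
    simp only [wedge, List.map_map, map_list_prod]
    congr 2
    funext v
    simp [f]
  rw [key, key, h]
  simp [Units.smul_def]

theorem map_symm_eq {X X' : Submodule k V} {σ : V ≃ₗ[k] V} (h : X.map (σ : V →ₗ[k] V) = X') :
    X'.map (σ.symm : V →ₗ[k] V) = X := by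
  rw [← h, ← Submodule.map_comp]; simp

theorem IsFrame.pullback {N X X' : Submodule k V} {x : List V} (σ : V ≃ₗ[k] V)
    (hX : X.map (σ : V →ₗ[k] V) = X') (h : IsFrame N X' x) :
    IsFrame (N.map (σ.symm : V →ₗ[k] V)) X (x.map σ.symm) := by
  have := h.map σ.symm
  rwa [map_symm_eq hX] at this

/-- The map `(X | Y) → (σ X | σ Y)` induced by an automorphism `σ`. -/
def DetIso.transport {X Y X' Y' : Submodule k V} (c : DetIso X Y) (σ : V ≃ₗ[k] V)
    (hX : X.map (σ : V →ₗ[k] V) = X') (hY : Y.map (σ : V →ₗ[k] V) = Y') : DetIso X' Y' where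
  coeff hx hy := c.coeff (hx.pullback σ hX) (hy.pullback σ hY)
  basis_change hx hx' hy hy' α β hα hβ :=
    c.basis_change _ _ _ _ α β (wedge_map σ.symm hα) (wedge_map σ.symm hβ)
  shrink {M N w x y} hw hx hy := by
    simp only [List.map_append]
    exact c.shrink (hw.map σ.symm) (hx.pullback σ hX) (hy.pullback σ hY)

/-- The contraction `(X | Y) × (Y | Z) → (X | Z)`; see `DetIso.comp_coeff`. -/
noncomputable def DetIso.comp {X Y Z : Submodule k V} (c : DetIso X Y) (d : DetIso Y Z)
    (hXY : Commensurable X Y) (hYZ : Commensurable Y Z) : DetIso X Z :=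
  (DetIso.exists_comp hXY hYZ c d).choose

theorem DetIso.comp_coeff {X Y Z : Submodule k V} (c : DetIso X Y) (d : DetIso Y Z)
    (hXY : Commensurable X Y) (hYZ : Commensurable Y Z) {N : Submodule k V} {x y z : List V}
    (hx : IsFrame N X x) (hy : IsFrame N Y y) (hz : IsFrame N Z z) :
    (c.comp d hXY hYZ).coeff hx hz = c.coeff hx hy * d.coeff hy hz :=
  (DetIso.exists_comp hXY hYZ c d).choose_spec hx hy hz

/-- The inverse element of `(Y | X)`. -/
def DetIso.symm {X Y : Submodule k V} (c : DetIso X Y) : DetIso Y X where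
  coeff hy hx := (c.coeff hx hy)⁻¹
  basis_change hy hy' hx hx' β α hβ hα := by
    have := c.basis_change hx hx' hy hy' α β hα hβ
    rw [← eq_inv_mul_iff_mul_eq] at this
    rw [this, mul_inv, mul_inv, inv_inv]
    calc β * (α * (β⁻¹ * (c.coeff hx hy)⁻¹)) = (β * β⁻¹) * (α * (c.coeff hx hy)⁻¹) := by ac_rfl
      _ = _ := by rw [mul_inv_cancel, one_mul]
  shrink hw hy hx := by rw [c.shrink hw hx hy]

theorem DetIso.coeff_congr {X Y : Submodule k V} (c : DetIso X Y) {N N' : Submodule k V}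
    {x x' y y' : List V} (hN : N = N') (hxx : x = x') (hyy : y = y') (hx : IsFrame N X x)
    (hx' : IsFrame N' X x') (hy : IsFrame N Y y) (hy' : IsFrame N' Y y') :
    c.coeff hx hy = c.coeff hx' hy' := by
  subst hN hxx hyy; rfl

/-- The group `GL(V, A)` of all automorphisms `σ` of `V` such that `σ A` is commensurable with `A`. -/
def GLComm (A : Submodule k V) : Subgroup (V ≃ₗ[k] V) where
  carrier := {σ | Commensurable (A.map (σ : V →ₗ[k] V)) A}
  one_mem' := by
    have : A.map ((1 : V ≃ₗ[k] V) : V →ₗ[k] V) = A := Submodule.map_id A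
    simpa [this] using Commensurable.refl A
  mul_mem' := by
    intro σ τ hσ hτ
    have : A.map ((σ * τ : V ≃ₗ[k] V) : V →ₗ[k] V) = (A.map (τ : V →ₗ[k] V)).map
      (σ : V →ₗ[k] V) := Submodule.map_comp _ _ _
    simp only [Set.mem_ofPred_eq] at *
    rw [this]
    exact (hτ.map _).trans hσ
  inv_mem' := by
    intro σ hσ
    have : (A.map (σ : V →ₗ[k] V)).map ((σ⁻¹ : V ≃ₗ[k] V) : V →ₗ[k] V) = A := map_symm_eq rfl
    have h := Commensurable.map hσ ((σ⁻¹ : V ≃ₗ[k] V) : V →ₗ[k] V)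
    rw [this] at h
    exact h.symm

theorem mem_GLComm {A : Submodule k V} {σ : V ≃ₗ[k] V} :
    σ ∈ GLComm A ↔ Commensurable (A.map (σ : V →ₗ[k] V)) A := Iff.rfl

/-- The determinantal extension of `GL(V, A)`: pairs of some `σ` in `GL(V, A)` and a nonzero element
of the line `(A | σ A)`, with the product `(σ, s) (τ, t) = (σ τ, s · σ(t))`. -/
structure DetExt (A : Submodule k V) where
  toGL : GLComm A
  det : DetIso A (A.map ((toGL : V ≃ₗ[k] V) : V →ₗ[k] V))

namespace DetExt

variable {A : Submodule k V}

theorem ext_of_coeff {s t : DetExt A} (h : s.toGL = t.toGL) {N : Submodule k V} {a x : List V}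
    (ha : IsFrame N A a) (hx : IsFrame N (A.map ((s.toGL : V ≃ₗ[k] V) : V →ₗ[k] V)) x)
    (hx' : IsFrame N (A.map ((t.toGL : V ≃ₗ[k] V) : V →ₗ[k] V)) x)
    (hc : s.det.coeff ha hx = t.det.coeff ha hx') : s = t := by
  obtain ⟨σ, c⟩ := s
  obtain ⟨τ, d⟩ := t
  obtain rfl : σ = τ := h
  congr
  exact DetIso.ext_of_coeff ha hx hc

theorem map_mul (σ τ : GLComm A) : (A.map ((τ : V ≃ₗ[k] V) : V →ₗ[k] V)).map
    ((σ : V ≃ₗ[k] V) : V →ₗ[k] V) = A.map (((σ * τ : GLComm A) : V ≃ₗ[k] V) : V →ₗ[k] V) :=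
  (Submodule.map_comp _ _ _).symm

theorem map_one : A.map (((1 : GLComm A) : V ≃ₗ[k] V) : V →ₗ[k] V) = A := Submodule.map_id A

theorem commensurable_map_mul (σ τ : GLComm A) :
    Commensurable (A.map ((σ : V ≃ₗ[k] V) : V →ₗ[k] V))
      (A.map (((σ * τ : GLComm A) : V ≃ₗ[k] V) : V →ₗ[k] V)) :=
  (mem_GLComm.1 σ.2).trans (mem_GLComm.1 (σ * τ).2).symm

noncomputable instance : Mul (DetExt A) where
  mul s t := ⟨s.toGL * t.toGL, s.det.comp
    (t.det.transport (s.toGL : V ≃ₗ[k] V) rfl (map_mul s.toGL t.toGL))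
    (mem_GLComm.1 s.toGL.2).symm (commensurable_map_mul s.toGL t.toGL)⟩

/-- The pair of the identity and of the scalar `r`, an element of `(A | A) = k`. -/
noncomputable def scalar (A : Submodule k V) (r : kˣ) : DetExt A where
  toGL := 1
  det := (exists_detIso (X := A) (isFrame_nil.2 rfl) (isFrame_nil.2 map_one.symm) r).choose

noncomputable instance : One (DetExt A) := ⟨scalar A 1⟩

noncomputable instance : Inv (DetExt A) where
  inv s := ⟨s.toGL⁻¹, s.det.symm.transport ((s.toGL⁻¹ : GLComm A) : V ≃ₗ[k] V) (map_symm_eq rfl) rfl⟩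

theorem toGL_mul (s t : DetExt A) : (s * t).toGL = s.toGL * t.toGL := rfl

theorem toGL_one : (1 : DetExt A).toGL = 1 := rfl

theorem toGL_inv (s : DetExt A) : (s⁻¹).toGL = s.toGL⁻¹ := rfl

theorem isFrame_symm (σ τ : GLComm A) {N : Submodule k V} {x : List V}
    (h : IsFrame N (A.map (((σ * τ : GLComm A) : V ≃ₗ[k] V) : V →ₗ[k] V)) x) :
    IsFrame (N.map ((σ : V ≃ₗ[k] V).symm : V →ₗ[k] V))
      (A.map ((τ : V ≃ₗ[k] V) : V →ₗ[k] V)) (x.map (σ : V ≃ₗ[k] V).symm) :=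
  h.pullback _ (map_mul σ τ)

theorem isFrame_symm_self (σ : GLComm A) {N : Submodule k V} {x : List V}
    (h : IsFrame N (A.map ((σ : V ≃ₗ[k] V) : V →ₗ[k] V)) x) :
    IsFrame (N.map ((σ : V ≃ₗ[k] V).symm : V →ₗ[k] V)) A (x.map (σ : V ≃ₗ[k] V).symm) :=
  h.pullback _ rfl

theorem mul_coeff (s t : DetExt A) {N : Submodule k V} {a x y : List V} (ha : IsFrame N A a)
    (hx : IsFrame N (A.map ((s.toGL : V ≃ₗ[k] V) : V →ₗ[k] V)) x)
    (hy : IsFrame N (A.map (((s.toGL * t.toGL : GLComm A) : V ≃ₗ[k] V) : V →ₗ[k] V)) y) :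
    (s * t).det.coeff ha hy =
      s.det.coeff ha hx * t.det.coeff (isFrame_symm_self s.toGL hx) (isFrame_symm s.toGL t.toGL hy) :=
  DetIso.comp_coeff s.det (t.det.transport (s.toGL : V ≃ₗ[k] V) rfl (map_mul s.toGL t.toGL))
    (mem_GLComm.1 s.toGL.2).symm (commensurable_map_mul s.toGL t.toGL) ha hx hy

theorem scalar_coeff (r : kˣ) {N : Submodule k V} {a : List V} (ha : IsFrame N A a)
    (ha' : IsFrame N (A.map (((1 : GLComm A) : V ≃ₗ[k] V) : V →ₗ[k] V)) a) :
    (scalar A r).det.coeff ha ha' = r := by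
  have h := (exists_detIso (X := A) (isFrame_nil.2 rfl) (isFrame_nil.2 map_one.symm) r).choose_spec
  have h' := (scalar A r).det.shrink ha (isFrame_nil.2 rfl) (isFrame_nil.2 map_one.symm)
  rw [show (scalar A r).det.coeff (isFrame_nil.2 rfl) (isFrame_nil.2 map_one.symm) = r from h] at h'
  refine Eq.trans ?_ h'
  exact DetIso.coeff_congr (scalar A r).det rfl (List.append_nil a).symm (List.append_nil a).symm _ _ _ _

theorem exists_frames (ρ : List (GLComm A)) : ∃ N : Submodule k V, (∃ a, IsFrame N A a) ∧
    ∀ σ ∈ ρ, ∃ x, IsFrame N (A.map ((σ : V ≃ₗ[k] V) : V →ₗ[k] V)) x := by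
  have : ∃ N : Submodule k V, N ≤ A ∧ FinOver A N ∧
      ∀ σ ∈ ρ, N ≤ A.map ((σ : V ≃ₗ[k] V) : V →ₗ[k] V) := by
    induction ρ with
    | nil => exact ⟨A, le_rfl, finOver_of_le le_rfl, by simp⟩
    | cons σ l ih =>
      obtain ⟨N, h1, h2, h3⟩ := ih
      have hσ := commensurable_iff.1 (mem_GLComm.1 σ.2)
      refine ⟨N ⊓ A.map ((σ : V ≃ₗ[k] V) : V →ₗ[k] V), inf_le_left.trans h1, h2.inf hσ.2, ?_⟩
      intro τ hτ
      rcases List.mem_cons.1 hτ with rfl | hτ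
      · exact inf_le_right
      · exact inf_le_left.trans (h3 τ hτ)
  obtain ⟨N, h1, h2, h3⟩ := this
  refine ⟨N, exists_isFrame h1 h2, fun σ hσ => exists_isFrame (h3 σ hσ) ?_⟩
  exact (commensurable_iff.1 (mem_GLComm.1 σ.2)).1.trans h2

theorem mul_assoc' (s t u : DetExt A) : s * t * u = s * (t * u) := by
  obtain ⟨N, ⟨a, ha⟩, h⟩ := exists_frames
    [s.toGL, s.toGL * t.toGL, s.toGL * t.toGL * u.toGL]
  obtain ⟨x, hx⟩ := h s.toGL (by simp)
  obtain ⟨y, hy⟩ := h (s.toGL * t.toGL) (by simp)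
  obtain ⟨z, hz⟩ := h (s.toGL * t.toGL * u.toGL) (by simp)
  have hz' : IsFrame N (A.map (((s.toGL * (t.toGL * u.toGL) : GLComm A) : V ≃ₗ[k] V) :
    V →ₗ[k] V)) z := by rwa [← mul_assoc]
  refine ext_of_coeff (mul_assoc s.toGL t.toGL u.toGL) ha hz hz' ?_
  rw [mul_coeff (s * t) u ha hy hz, mul_coeff s t ha hx hy, mul_coeff s (t * u) ha hx hz',
    mul_coeff t u (isFrame_symm_self s.toGL hx) (isFrame_symm s.toGL t.toGL hy)
      (isFrame_symm s.toGL (t.toGL * u.toGL) hz'), mul_assoc]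
  congr 2
  refine DetIso.coeff_congr _ ?_ ?_ ?_ _ _ _ _
  · rw [← Submodule.map_comp]; rfl
  · rw [List.map_map]; rfl
  · rw [List.map_map]; rfl

theorem one_mul' (s : DetExt A) : 1 * s = s := by
  obtain ⟨N, ⟨a, ha⟩, h⟩ := exists_frames [s.toGL]
  obtain ⟨x, hx⟩ := h s.toGL (by simp)
  have hx' : IsFrame N (A.map (((1 * s.toGL : GLComm A) : V ≃ₗ[k] V) : V →ₗ[k] V)) x := by
    rwa [one_mul]
  have ha' : IsFrame N (A.map (((1 : GLComm A) : V ≃ₗ[k] V) : V →ₗ[k] V)) a := by rwa [map_one]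
  refine ext_of_coeff (one_mul s.toGL) ha hx' hx ?_
  rw [mul_coeff 1 s ha ha' hx', show (1 : DetExt A).det.coeff ha ha' = 1 from scalar_coeff 1 ha ha',
    one_mul]
  refine DetIso.coeff_congr _ ?_ ?_ ?_ _ _ _ _
  · exact Submodule.map_id N
  · exact List.map_id a
  · exact List.map_id x

theorem inv_mul' (s : DetExt A) : s⁻¹ * s = 1 := by
  obtain ⟨N, ⟨a, ha⟩, h⟩ := exists_frames [s.toGL⁻¹]
  obtain ⟨x, hx⟩ := h s.toGL⁻¹ (by simp)
  have ha₁ : IsFrame N (A.map (((s.toGL⁻¹ * s.toGL : GLComm A) : V ≃ₗ[k] V) : V →ₗ[k] V)) a := by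
    rwa [inv_mul_cancel, map_one]
  have ha' : IsFrame N (A.map (((1 : GLComm A) : V ≃ₗ[k] V) : V →ₗ[k] V)) a := by rwa [map_one]
  refine ext_of_coeff (inv_mul_cancel s.toGL) ha ha₁ ha' ?_
  rw [mul_coeff s⁻¹ s ha hx ha₁, show (1 : DetExt A).det.coeff ha ha' = 1 from scalar_coeff 1 ha ha']
  exact inv_mul_cancel _

noncomputable instance : Group (DetExt A) :=
  Group.ofLeftAxioms mul_assoc' one_mul' inv_mul'

theorem scalar_mul (r t : kˣ) : scalar A (r * t) = scalar A r * scalar A t := by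
  have h0 : IsFrame A A ([] : List V) := isFrame_nil.2 rfl
  have h1 : IsFrame A (A.map (((1 : GLComm A) : V ≃ₗ[k] V) : V →ₗ[k] V)) [] :=
    isFrame_nil.2 map_one.symm
  have h2 : IsFrame A (A.map (((1 * 1 : GLComm A) : V ≃ₗ[k] V) : V →ₗ[k] V)) [] :=
    isFrame_nil.2 (by rw [one_mul, map_one])
  refine ext_of_coeff (one_mul (1 : GLComm A)).symm h0 h1 h2 ?_
  rw [mul_coeff (scalar A r) (scalar A t) h0 h1 h2, scalar_coeff, scalar_coeff]
  congr 1
  exact (scalar_coeff t _ _).symm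

theorem scalar_comm (r : kˣ) (s : DetExt A) : scalar A r * s = s * scalar A r := by
  obtain ⟨N, ⟨a, ha⟩, h⟩ := exists_frames [s.toGL]
  obtain ⟨x, hx⟩ := h s.toGL (by simp)
  have hx₁ : IsFrame N (A.map (((1 * s.toGL : GLComm A) : V ≃ₗ[k] V) : V →ₗ[k] V)) x := by
    rwa [one_mul]
  have hx₂ : IsFrame N (A.map (((s.toGL * 1 : GLComm A) : V ≃ₗ[k] V) : V →ₗ[k] V)) x := by
    rwa [mul_one]
  have ha' : IsFrame N (A.map (((1 : GLComm A) : V ≃ₗ[k] V) : V →ₗ[k] V)) a := by rwa [map_one]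
  refine ext_of_coeff ((one_mul s.toGL).trans (mul_one s.toGL).symm) ha hx₁ hx₂ ?_
  rw [mul_coeff (scalar A r) s ha ha' hx₁, mul_coeff s (scalar A r) ha hx hx₂, scalar_coeff,
    mul_comm]
  congr 1
  · refine DetIso.coeff_congr _ ?_ ?_ ?_ _ _ _ _
    · exact Submodule.map_id N
    · exact List.map_id a
    · exact List.map_id x
  · exact (scalar_coeff r _ _).symm

end DetExt

/-- The determinantal central extension `1 → kˣ → DetExt A → GL(V, A) → 1`. -/
noncomputable def centralExtension (A : Submodule k V) : GroupExtension kˣ (DetExt A) (GLComm A) where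
  inl := MonoidHom.mk' (DetExt.scalar A) DetExt.scalar_mul
  rightHom := MonoidHom.mk' DetExt.toGL DetExt.toGL_mul
  inl_injective := by
    intro r t h
    have h0 : IsFrame A A ([] : List V) := isFrame_nil.2 rfl
    have h1 : IsFrame A (A.map (((1 : GLComm A) : V ≃ₗ[k] V) : V →ₗ[k] V)) [] :=
      isFrame_nil.2 DetExt.map_one.symm
    have h : DetExt.scalar A r = DetExt.scalar A t := h
    rw [← DetExt.scalar_coeff r h0 h1, ← DetExt.scalar_coeff t h0 h1]
    rw [DetExt.scalar, DetExt.scalar, DetExt.mk.injEq] at h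
    exact congrArg (fun c : DetIso A _ => c.coeff h0 h1) (eq_of_heq h.2)
  range_inl_eq_ker_rightHom := by
    ext s
    constructor
    · rintro ⟨r, rfl⟩; rfl
    · intro hs
      have hs : s.toGL = 1 := hs
      have h0 : IsFrame A A ([] : List V) := isFrame_nil.2 rfl
      have h1 : IsFrame A (A.map (((1 : GLComm A) : V ≃ₗ[k] V) : V →ₗ[k] V)) [] :=
        isFrame_nil.2 DetExt.map_one.symm
      have h2 : IsFrame A (A.map ((s.toGL : V ≃ₗ[k] V) : V →ₗ[k] V)) [] := by rwa [hs]
      exact ⟨s.det.coeff h0 h2, DetExt.ext_of_coeff hs.symm h0 h1 h2 (DetExt.scalar_coeff _ h0 h1)⟩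
  rightHom_surjective := by
    intro σ
    obtain ⟨N, ⟨a, ha⟩, h⟩ := DetExt.exists_frames [σ]
    obtain ⟨x, hx⟩ := h σ (by simp)
    exact ⟨⟨σ, (exists_detIso ha hx 1).choose⟩, rfl⟩

theorem centralExtension_central (A : Submodule k V) (r : kˣ) (s : DetExt A) :
    Commute ((centralExtension A).inl r) s := DetExt.scalar_comm r s

theorem existsUnique_commutator {A : Submodule k V} {σ τ : GLComm A} (h : Commute σ τ) :
    ∃! c : kˣ, ∀ s t : DetExt A, (centralExtension A).rightHom s = σ →
      (centralExtension A).rightHom t = τ → (centralExtension A).inl c = s * t * s⁻¹ * t⁻¹ := by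
  obtain ⟨s₀, hs₀⟩ := (centralExtension A).rightHom_surjective σ
  obtain ⟨t₀, ht₀⟩ := (centralExtension A).rightHom_surjective τ
  have hker : ∀ s : DetExt A, (centralExtension A).rightHom s = 1 →
      ∃ r, (centralExtension A).inl r = s := by
    intro s hs
    have : s ∈ (centralExtension A).rightHom.ker := hs
    rwa [← (centralExtension A).range_inl_eq_ker_rightHom] at this
  obtain ⟨c, hc⟩ := hker (s₀ * t₀ * s₀⁻¹ * t₀⁻¹) (by
    simp only [_root_.map_mul, map_inv, hs₀, ht₀]
    rw [h.eq]; group)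
  refine ⟨c, ?_, ?_⟩
  · intro s t hs ht
    obtain ⟨a, ha⟩ := hker (s * s₀⁻¹) (by simp [hs, hs₀])
    obtain ⟨b, hb⟩ := hker (t * t₀⁻¹) (by simp [ht, ht₀])
    obtain rfl : s = (centralExtension A).inl a * s₀ := by rw [ha]; group
    obtain rfl : t = (centralExtension A).inl b * t₀ := by rw [hb]; group
    have ca := centralExtension_central A a
    have cb := centralExtension_central A b
    rw [hc]
    generalize (centralExtension A).inl a = x at *
    generalize (centralExtension A).inl b = y at *
    symm
    calc x * s₀ * (y * t₀) * (x * s₀)⁻¹ * (y * t₀)⁻¹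
        = x * (s₀ * y) * t₀ * s₀⁻¹ * x⁻¹ * t₀⁻¹ * y⁻¹ := by group
      _ = x * (y * s₀ * t₀ * s₀⁻¹) * x⁻¹ * t₀⁻¹ * y⁻¹ := by rw [← (cb s₀).eq]; group
      _ = y * (s₀ * t₀ * s₀⁻¹ * t₀⁻¹) * y⁻¹ := by rw [(ca _).eq]; group
      _ = _ := by rw [(cb _).eq]; group
  · intro c' hc'
    exact (centralExtension A).inl_injective ((hc' s₀ t₀ hs₀ ht₀).trans hc.symm)

/-- The commutator `{σ, τ}` of the central extension: the unique scalar equal to `s t s⁻¹ t⁻¹` for all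
lifts `s` of `σ` and `t` of `τ`. -/
noncomputable def commutatorPairing (A : Submodule k V) (σ τ : GLComm A) (h : Commute σ τ) : kˣ :=
  (existsUnique_commutator h).choose

/-- The index `dim (A / (A ∩ σ A)) - dim (σ A / (A ∩ σ A))`. -/
noncomputable def index (A : Submodule k V) (σ : V ≃ₗ[k] V) : ℤ :=
  (Module.finrank k (A ⧸ (A ⊓ A.map (σ : V →ₗ[k] V)).submoduleOf A) : ℤ) -
    Module.finrank k (A.map (σ : V →ₗ[k] V) ⧸
      (A ⊓ A.map (σ : V →ₗ[k] V)).submoduleOf (A.map (σ : V →ₗ[k] V)))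

/-- The tame symbol `(-1) ^ (i(σ) i(τ)) {σ, τ}` associated with `A`. -/
noncomputable def tameSymbol (A : Submodule k V) (σ τ : GLComm A) (h : Commute σ τ) : kˣ :=
  (-1) ^ (index A (σ : V ≃ₗ[k] V) * index A (τ : V ≃ₗ[k] V)) * commutatorPairing A σ τ h

/-! ### The restricted linear group of a family of subspaces -/

variable {I : Type*}

/-- The restricted linear group of a family `Vs`: all `σ` in every `GL(V, Vs i)` such that
`σ (Vs i) = Vs i` for all but finitely many `i`. -/
def restrictedGL (Vs : I → Submodule k V) : Subgroup (V ≃ₗ[k] V) where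
  carrier := {σ | (∀ i, σ ∈ GLComm (Vs i)) ∧
    {i | (Vs i).map (σ : V →ₗ[k] V) ≠ Vs i}.Finite}
  one_mem' := ⟨fun i => one_mem _, by
    convert Set.finite_empty
    ext i
    simp only [Set.mem_ofPred_eq, Set.mem_empty_iff_false, iff_false, not_not]
    exact Submodule.map_id (Vs i)⟩
  mul_mem' {σ τ} hσ hτ := ⟨fun i => mul_mem (hσ.1 i) (hτ.1 i), by
    refine (hσ.2.union hτ.2).subset fun i hi => ?_
    by_contra hc
    simp only [Set.mem_union, Set.mem_ofPred_eq, not_or, not_not] at hc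
    apply hi
    have : (Vs i).map ((σ * τ : V ≃ₗ[k] V) : V →ₗ[k] V) = ((Vs i).map (τ : V →ₗ[k] V)).map
      (σ : V →ₗ[k] V) := Submodule.map_comp _ _ _
    rw [this, hc.2, hc.1]⟩
  inv_mem' {σ} hσ := ⟨fun i => inv_mem (hσ.1 i), by
    refine hσ.2.subset fun i hi hc => hi ?_
    exact map_symm_eq hc⟩

/-- The automorphism of `W` induced by an automorphism `σ` of `V` with `σ W = W`. -/
def restrictEquiv (W : Submodule k V) (σ : V ≃ₗ[k] V) (h : W.map (σ : V →ₗ[k] V) = W) :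
    W ≃ₗ[k] W :=
  σ.ofSubmodules W W h

/-- The diagonal action of `σ` on the product of the `W i`. -/
def diagEquiv (W : I → Submodule k V) (σ : V ≃ₗ[k] V)
    (h : ∀ i, (W i).map (σ : V →ₗ[k] V) = W i) : (∀ i, W i) ≃ₗ[k] (∀ i, W i) :=
  LinearEquiv.piCongrRight fun i => restrictEquiv (W i) σ (h i)

theorem FinOver.comap {V' : Type*} [AddCommGroup V'] [Module k V'] {A B : Submodule k V}
    (h : FinOver A B) (f : V' →ₗ[k] V) : FinOver (A.comap f) (B.comap f) := by
  rw [finOver_iff_map] at *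
  let g : (V' ⧸ B.comap f) →ₗ[k] V ⧸ B := (B.comap f).mapQ B f le_rfl
  have hg : Function.Injective g := by
    rw [← LinearMap.ker_eq_bot, Submodule.ker_mapQ, Submodule.mkQ_map_self]
  have hle : ((A.comap f).map (B.comap f).mkQ).map g ≤ A.map B.mkQ := by
    rintro _ ⟨_, ⟨x, hx, rfl⟩, rfl⟩
    exact ⟨f x, hx, rfl⟩
  have := Submodule.finiteDimensional_of_le hle
  exact Module.Finite.equiv (Submodule.equivMapOfInjective g hg _).symm

theorem FinOver.pi {W : I → Type*} [∀ i, AddCommGroup (W i)] [∀ i, Module k (W i)]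
    {A B : ∀ i, Submodule k (W i)} (h : ∀ i, FinOver (A i) (B i))
    (hfin : {i | ¬ A i ≤ B i}.Finite) :
    FinOver (Submodule.pi Set.univ A) (Submodule.pi Set.univ B) := by
  classical
  choose F hF hAF using h
  refine ⟨hfin.toFinset.sup fun i => (F i).map (LinearMap.single k W i), ?_, ?_⟩
  · exact Submodule.fg_finset_sup _ _ fun i _ => (hF i).map _
  · intro x hx
    have hx : ∀ i, x i ∈ A i := fun i => hx i trivial
    have hs : ∀ i, ∃ b ∈ B i, ∃ f ∈ F i, b + f = x i := fun i => Submodule.mem_sup.1 (hAF i (hx i))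
    choose b hb f hf e using hs
    let y : ∀ i, W i := ∑ i ∈ hfin.toFinset, LinearMap.single k W i (f i)
    have hy : ∀ j, y j = if j ∈ hfin.toFinset then f j else 0 := by
      intro j
      simp only [y, Finset.sum_apply, LinearMap.single_apply]
      by_cases hj : j ∈ hfin.toFinset
      · rw [if_pos hj, Finset.sum_eq_single_of_mem j hj]
        · simp
        · intro i _ hij; simp [Pi.single_eq_of_ne hij.symm]
      · rw [if_neg hj]
        refine Finset.sum_eq_zero fun i hi => ?_
        rw [Pi.single_eq_of_ne]; rintro rfl; exact hj hi
    refine Submodule.mem_sup.2 ⟨x - y, ?_, y, ?_, sub_add_cancel x y⟩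
    · intro j _
      rw [Pi.sub_apply, hy]
      split_ifs with hj
      · rw [← e j, add_sub_cancel_right]; exact hb j
      · rw [sub_zero]
        have : A j ≤ B j := by
          by_contra hc; exact hj (hfin.mem_toFinset.2 hc)
        exact this (hx j)
    · refine Submodule.sum_mem _ fun i hi => ?_
      exact (Finset.le_sup (f := fun i => (F i).map (LinearMap.single k W i)) hi) ⟨f i, hf i, rfl⟩

/-- The subgroup of those `σ` in the restricted linear group of `Vs` with `σ (Ws i) = Ws i` for all `i`. -/
def stableGL (Vs Ws : I → Submodule k V) : Subgroup (V ≃ₗ[k] V) where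
  carrier := {σ | σ ∈ restrictedGL Vs ∧ ∀ i, (Ws i).map (σ : V →ₗ[k] V) = Ws i}
  one_mem' := ⟨one_mem _, fun i => Submodule.map_id (Ws i)⟩
  mul_mem' {σ τ} hσ hτ := ⟨mul_mem hσ.1 hτ.1, fun i => by
    have : (Ws i).map ((σ * τ : V ≃ₗ[k] V) : V →ₗ[k] V) = ((Ws i).map (τ : V →ₗ[k] V)).map
      (σ : V →ₗ[k] V) := Submodule.map_comp _ _ _
    rw [this, hτ.2, hσ.2]⟩
  inv_mem' {σ} hσ := ⟨inv_mem hσ.1, fun i => map_symm_eq (hσ.2 i)⟩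

theorem restrictEquiv_map (W A : Submodule k V) (σ : V ≃ₗ[k] V)
    (h : W.map (σ : V →ₗ[k] V) = W) :
    (A.submoduleOf W).map (restrictEquiv W σ h : W →ₗ[k] W) =
      (A.map (σ : V →ₗ[k] V)).submoduleOf W := by
  ext x
  constructor
  · rintro ⟨y, hy, rfl⟩
    exact ⟨y, hy, rfl⟩
  · rintro ⟨v, hv, e⟩
    have hvW : v ∈ W := by
      have : (x : V) ∈ W.map (σ : V →ₗ[k] V) := h.symm ▸ x.2
      obtain ⟨w, hw, e'⟩ := this
      have : v = w := σ.injective (e.trans e'.symm)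
      rwa [this]
    exact ⟨⟨v, hvW⟩, hv, Subtype.ext e⟩

theorem diagEquiv_map (W : I → Submodule k V) (A : I → Submodule k V) (σ : V ≃ₗ[k] V)
    (h : ∀ i, (W i).map (σ : V →ₗ[k] V) = W i) :
    (Submodule.pi Set.univ fun i => (A i).submoduleOf (W i)).map
        (diagEquiv W σ h : (∀ i, W i) →ₗ[k] ∀ i, W i) =
      Submodule.pi Set.univ fun i => ((A i).map (σ : V →ₗ[k] V)).submoduleOf (W i) := by
  ext x
  constructor
  · rintro ⟨y, hy, rfl⟩ i hi
    exact ⟨y i, hy i hi, rfl⟩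
  · intro hx
    refine ⟨(diagEquiv W σ h).symm x, fun i hi => ?_, (diagEquiv W σ h).apply_symm_apply x⟩
    have : x i ∈ ((A i).map (σ : V →ₗ[k] V)).submoduleOf (W i) := hx i hi
    rw [← restrictEquiv_map (W i) (A i) σ (h i)] at this
    obtain ⟨z, hz, e⟩ := this
    have : (diagEquiv W σ h).symm x i = z := by
      have e' : (restrictEquiv (W i) σ (h i)) ((diagEquiv W σ h).symm x i) = x i :=
        congrFun ((diagEquiv W σ h).apply_symm_apply x) i
      exact (restrictEquiv (W i) σ (h i)).injective (e'.trans e.symm)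
    rw [this]; exact hz

/-- The product of the `Vs i`, as a subspace of the product of the `Ws i`. -/
def prodSubmodule (Vs Ws : I → Submodule k V) : Submodule k (∀ i, Ws i) :=
  Submodule.pi Set.univ fun i => (Vs i).submoduleOf (Ws i)

/-- Restriction to `Ws i`, as a map to `GL(Ws i, Vs i)`. -/
def componentHom (Vs Ws : I → Submodule k V) (i : I) :
    stableGL Vs Ws →* GLComm ((Vs i).submoduleOf (Ws i)) where
  toFun σ := ⟨restrictEquiv (Ws i) σ (σ.2.2 i), by
    rw [mem_GLComm, restrictEquiv_map, commensurable_iff]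
    have := commensurable_iff.1 (mem_GLComm.1 (σ.2.1.1 i))
    exact ⟨this.1.comap _, this.2.comap _⟩⟩
  map_one' := rfl
  map_mul' _ _ := rfl

/-- The diagonal action on the product of the `Ws i`, as a map to `GL(∏ Ws i, ∏ Vs i)`. -/
def diagonalHom (Vs Ws : I → Submodule k V) :
    stableGL Vs Ws →* GLComm (prodSubmodule Vs Ws) where
  toFun σ := ⟨diagEquiv Ws σ σ.2.2, by
    rw [mem_GLComm, prodSubmodule, diagEquiv_map, commensurable_iff]
    have h := fun i => commensurable_iff.1 (mem_GLComm.1 (σ.2.1.1 i))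
    refine ⟨FinOver.pi (fun i => (h i).1.comap _) (σ.2.1.2.subset ?_),
      FinOver.pi (fun i => (h i).2.comap _) (σ.2.1.2.subset ?_)⟩
    · intro i hi hc
      exact hi (by rw [hc])
    · intro i hi hc
      exact hi (by rw [hc])⟩
  map_one' := rfl
  map_mul' _ _ := rfl

end Tame

namespace Tame

open Submodule

variable {k V : Type*} [Field k] [AddCommGroup V] [Module k V]

/-! ### The index and the commutator in terms of frames -/

/-! The tame symbol behaves like a bilinear, antisymmetric pairing on commuting pairs: the
commutator of a central extension is bimultiplicative on such pairs, and the index is a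
homomorphism, so the sign is bimultiplicative as well. It is trivial when both automorphisms
preserve the lattice (`tameSymbol_eq_one`). A product formula over finitely many factors therefore
reduces to the case in which each automorphism acts on a single factor only.

Two computations settle that case. If both act on the same factor, the rest of the lattice is a
summand `C` which both preserve; it cancels from every relative determinant line, and the local
symbol remains (`tameSymbol_cancel`). If they act on complementary summands `P` and `Q`, and the
lattice splits accordingly, lifts commute up to the sign made by moving wedge products past each
other. That sign is `(-1) ^ (i(σ) i(τ))`, exactly the one built into the tame symbol, so the symbol
is 1 (`tameSymbol_eq_one_of_disjoint`). This is why the product formula holds for the tame symbol,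
with its sign, and not for the bare commutator.

In the infinite product, only finitely many factors have their lattice moved by `σ` or `τ`.
Splitting off these factors one at a time (`tameSymbol_pi_eq_prod`) leaves a pair that preserves the
whole product lattice and has symbol 1.

All commutators are computed in coordinates: `commutatorPairing_coeff` expresses them by
coefficients of two lifts on frames relative to one common `N`. -/

theorem wedge_cons (N : Submodule k V) (v : V) (l : List V) :
    wedge N (v :: l) = ExteriorAlgebra.ι k (N.mkQ v) * wedge N l := by simp [wedge]

theorem ι_mul_wedge (N : Submodule k V) (v : V) (l : List V) :
    ExteriorAlgebra.ι k (N.mkQ v) * wedge N l =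
      ((-1 : kˣ) ^ l.length) • (wedge N l * ExteriorAlgebra.ι k (N.mkQ v)) := by
  induction l with
  | nil => simp [wedge]
  | cons w l ih =>
    have e : ExteriorAlgebra.ι k (N.mkQ v) * ExteriorAlgebra.ι k (N.mkQ w) =
        -(ExteriorAlgebra.ι k (N.mkQ w) * ExteriorAlgebra.ι k (N.mkQ v)) :=
      eq_neg_of_add_eq_zero_left (ExteriorAlgebra.ι_add_mul_swap _ _)
    rw [wedge_cons, ← mul_assoc, e, neg_mul, mul_assoc, ih, List.length_cons, pow_succ, mul_smul,
      mul_smul_comm, mul_assoc]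
    simp [Units.smul_def]

/-- Each vector of `x` passes each vector of `y` once. Every sign in the commutator computations
below comes from this exchange. -/
theorem wedge_swap (N : Submodule k V) (x y : List V) :
    wedge N (x ++ y) = ((-1 : kˣ) ^ (x.length * y.length)) • wedge N (y ++ x) := by
  induction x with
  | nil => simp
  | cons v l ih =>
    rw [List.cons_append, wedge_cons, ih, wedge_append, mul_smul_comm, ← mul_assoc, ι_mul_wedge,
      smul_mul_assoc, smul_smul, mul_assoc, ← wedge_cons, ← wedge_append, List.length_cons,
      Nat.succ_mul, pow_add]

theorem IsFrame.finrank_quotient {N X : Submodule k V} {x : List V} (h : IsFrame N X x) :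
    Module.finrank k (X ⧸ N.submoduleOf X) = x.length := by
  have hk : LinearMap.ker (N.mkQ ∘ₗ X.subtype) = N.submoduleOf X := by
    ext x; simp [Submodule.submoduleOf]
  have e := (Submodule.quotEquivOfEq _ _ hk).symm.trans (N.mkQ ∘ₗ X.subtype).quotKerEquivRange
  rw [LinearMap.range_comp, Submodule.range_subtype] at e
  have hU : X.map N.mkQ = span k (Set.range (fun i : Fin x.length => N.mkQ x[i])) := by
    rw [← h.sup_span, Submodule.map_sup, Submodule.map_span, N.mkQ_map_self, bot_sup_eq]
    congr 1
    ext q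
    constructor
    · rintro ⟨v, hv, rfl⟩
      obtain ⟨i, hi, rfl⟩ := List.getElem_of_mem hv
      exact ⟨⟨i, hi⟩, rfl⟩
    · rintro ⟨i, rfl⟩
      exact ⟨_, List.getElem_mem _, rfl⟩
  rw [e.finrank_eq, hU, finrank_span_eq_card h.linearIndependent, Fintype.card_fin]

theorem IsFrame.length_eq {N X : Submodule k V} {x y : List V} (hx : IsFrame N X x)
    (hy : IsFrame N X y) : x.length = y.length :=
  hx.finrank_quotient.symm.trans hy.finrank_quotient

/-- The part `(A ∩ σ A) / N` contributes equally to both lengths, so any common `N` may replace the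
intersection. -/
theorem index_eq {A : Submodule k V} {σ : V ≃ₗ[k] V} {N : Submodule k V} {a x : List V}
    (ha : IsFrame N A a) (hx : IsFrame N (A.map (σ : V →ₗ[k] V)) x) :
    index A σ = (a.length : ℤ) - x.length := by
  have hN : N ≤ A ⊓ A.map (σ : V →ₗ[k] V) := le_inf ha.le hx.le
  obtain ⟨w, hw⟩ := exists_isFrame hN ((finOver_of_le inf_le_left).trans ha.finOver)
  obtain ⟨u, hu⟩ := exists_isFrame (N := A ⊓ A.map (σ : V →ₗ[k] V)) (X := A) inf_le_left
    (ha.finOver.trans (finOver_of_le hN))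
  obtain ⟨v, hv⟩ := exists_isFrame (N := A ⊓ A.map (σ : V →ₗ[k] V))
    (X := A.map (σ : V →ₗ[k] V)) inf_le_right (hx.finOver.trans (finOver_of_le hN))
  rw [index, hu.finrank_quotient, hv.finrank_quotient, ha.length_eq (hw.append hu),
    hx.length_eq (hw.append hv)]
  simp

theorem index_mul {A : Submodule k V} (σ τ : GLComm A) :
    index A ((σ * τ : GLComm A) : V ≃ₗ[k] V) =
      index A (σ : V ≃ₗ[k] V) + index A (τ : V ≃ₗ[k] V) := by
  obtain ⟨N, ⟨a, ha⟩, h⟩ := DetExt.exists_frames [σ, σ * τ]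
  obtain ⟨x, hx⟩ := h σ (by simp)
  obtain ⟨y, hy⟩ := h (σ * τ) (by simp)
  -- Applying `σ⁻¹` turns the frames of `σ A` and `σ τ A` into frames of `A` and `τ A`, so that
  -- `i(τ)` is `x.length - y.length` and the sum telescopes.
  rw [index_eq ha hy, index_eq ha hx,
    index_eq (DetExt.isFrame_symm_self σ hx) (DetExt.isFrame_symm σ τ hy)]
  simp

theorem index_eq_zero {A : Submodule k V} {σ : V ≃ₗ[k] V} (h : A.map (σ : V →ₗ[k] V) = A) :
    index A σ = 0 := by
  rw [index_eq (isFrame_nil.2 rfl) (isFrame_nil.2 h.symm)]; simp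

theorem commutatorPairing_spec {A : Submodule k V} {σ τ : GLComm A} (h : Commute σ τ)
    (s t : DetExt A) (hs : s.toGL = σ) (ht : t.toGL = τ) :
    (centralExtension A).inl (commutatorPairing A σ τ h) = s * t * s⁻¹ * t⁻¹ :=
  (existsUnique_commutator h).choose_spec.1 s t hs ht

theorem exists_lift {A : Submodule k V} (σ : GLComm A) : ∃ s : DetExt A, s.toGL = σ :=
  (centralExtension A).rightHom_surjective σ

theorem commutatorPairing_mul_left {A : Submodule k V} {σ σ' τ : GLComm A} (h : Commute σ τ)
    (h' : Commute σ' τ) : commutatorPairing A (σ * σ') τ (h.mul_left h') =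
      commutatorPairing A σ τ h * commutatorPairing A σ' τ h' := by
  obtain ⟨s, hs⟩ := exists_lift σ
  obtain ⟨s', hs'⟩ := exists_lift σ'
  obtain ⟨t, ht⟩ := exists_lift τ
  apply (centralExtension A).inl_injective
  rw [commutatorPairing_spec _ (s * s') t (by rw [DetExt.toGL_mul, hs, hs']) ht, _root_.map_mul,
    commutatorPairing_spec h s t hs ht]
  -- The commutator of `s'` and `t` sits inside that of `s * s'` and `t`; being central, it can be
  -- moved out.
  have hc := centralExtension_central A (commutatorPairing A σ' τ h') (t * s⁻¹ * t⁻¹)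
  have e := commutatorPairing_spec h' s' t hs' ht
  calc s * s' * t * (s * s')⁻¹ * t⁻¹ = s * ((s' * t * s'⁻¹ * t⁻¹) * (t * s⁻¹ * t⁻¹)) := by group
    _ = _ := by rw [← e, hc.eq]; group

theorem commutatorPairing_symm {A : Submodule k V} {σ τ : GLComm A} (h : Commute σ τ) :
    commutatorPairing A τ σ h.symm = (commutatorPairing A σ τ h)⁻¹ := by
  obtain ⟨s, hs⟩ := exists_lift σ
  obtain ⟨t, ht⟩ := exists_lift τ
  apply (centralExtension A).inl_injective
  rw [_root_.map_inv, commutatorPairing_spec _ s t hs ht, commutatorPairing_spec _ t s ht hs]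
  group

/-- This is the identity `c · (T S) = S T` in the extension, evaluated on the frames `a` of `A` and
`y` of `σ τ A = τ σ A`. The product in the extension is `s · σ(t)`, and `σ(t)` is read off on frames
pulled back by `σ⁻¹`; hence the second factor on each side. -/
theorem commutatorPairing_coeff {A : Submodule k V} {σ τ : GLComm A} (h : Commute σ τ)
    {N : Submodule k V} {a x y z : List V} (s : DetIso A (A.map ((σ : V ≃ₗ[k] V) : V →ₗ[k] V)))
    (t : DetIso A (A.map ((τ : V ≃ₗ[k] V) : V →ₗ[k] V))) (ha : IsFrame N A a)
    (hx : IsFrame N (A.map ((σ : V ≃ₗ[k] V) : V →ₗ[k] V)) x)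
    (hz : IsFrame N (A.map ((τ : V ≃ₗ[k] V) : V →ₗ[k] V)) z)
    (hy : IsFrame N (A.map (((σ * τ : GLComm A) : V ≃ₗ[k] V) : V →ₗ[k] V)) y)
    (hy' : IsFrame N (A.map (((τ * σ : GLComm A) : V ≃ₗ[k] V) : V →ₗ[k] V)) y) :
    commutatorPairing A σ τ h * (t.coeff ha hz *
      s.coeff (DetExt.isFrame_symm_self τ hz) (DetExt.isFrame_symm τ σ hy')) =
    s.coeff ha hx * t.coeff (DetExt.isFrame_symm_self σ hx) (DetExt.isFrame_symm σ τ hy) := by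
  let S : DetExt A := ⟨σ, s⟩
  let T : DetExt A := ⟨τ, t⟩
  have e : DetExt.scalar A (commutatorPairing A σ τ h) * (T * S) = S * T := by
    have := commutatorPairing_spec h S T rfl rfl
    change DetExt.scalar A _ = _ at this
    rw [this]; group
  have ha' : IsFrame N (A.map (((1 : GLComm A) : V ≃ₗ[k] V) : V →ₗ[k] V)) a := by
    rwa [DetExt.map_one]
  have hy1 : IsFrame N (A.map (((1 * (τ * σ) : GLComm A) : V ≃ₗ[k] V) : V →ₗ[k] V)) y := by
    rwa [one_mul]
  -- The type of a frame of `ρ A` depends on the element of the extension, so the equality is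
  -- transported to coefficients by substitution.
  have key : ∀ (X Y : DetExt A) (e : X = Y)
      (h₁ : IsFrame N (A.map ((X.toGL : V ≃ₗ[k] V) : V →ₗ[k] V)) y)
      (h₂ : IsFrame N (A.map ((Y.toGL : V ≃ₗ[k] V) : V →ₗ[k] V)) y),
      X.det.coeff ha h₁ = Y.det.coeff ha h₂ := by
    rintro X _ rfl _ _; rfl
  have := key _ _ e hy1 hy
  rw [DetExt.mul_coeff S T ha hx hy,
    DetExt.mul_coeff (DetExt.scalar A (commutatorPairing A σ τ h)) (T * S) ha ha' hy1,
    DetExt.scalar_coeff] at this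
  rw [← DetExt.mul_coeff T S ha hz hy']
  refine Eq.trans ?_ this
  congr 1
  -- What remains is the pullback by the identity underlying the scalar, which changes neither `N`
  -- nor the frames.
  refine DetIso.coeff_congr _ ?_ ?_ ?_ _ _ _ _
  · exact (Submodule.map_id N).symm
  · exact (List.map_id a).symm
  · exact (List.map_id y).symm

/-- With `N = A` all frames are empty and pulling back by `σ` or `τ` changes nothing, so both sides
of the coefficient identity contain the same two scalars. -/
theorem commutatorPairing_eq_one {A : Submodule k V} {σ τ : GLComm A} (h : Commute σ τ)
    (hσ : A.map ((σ : V ≃ₗ[k] V) : V →ₗ[k] V) = A) (hτ : A.map ((τ : V ≃ₗ[k] V) : V →ₗ[k] V) = A) :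
    commutatorPairing A σ τ h = 1 := by
  have ha : IsFrame A A [] := isFrame_nil.2 rfl
  have hx : IsFrame A (A.map ((σ : V ≃ₗ[k] V) : V →ₗ[k] V)) [] := isFrame_nil.2 hσ.symm
  have hz : IsFrame A (A.map ((τ : V ≃ₗ[k] V) : V →ₗ[k] V)) [] := isFrame_nil.2 hτ.symm
  have hy : IsFrame A (A.map (((σ * τ : GLComm A) : V ≃ₗ[k] V) : V →ₗ[k] V)) [] :=
    isFrame_nil.2 (by rw [← DetExt.map_mul, hτ, hσ])
  have hy' : IsFrame A (A.map (((τ * σ : GLComm A) : V ≃ₗ[k] V) : V →ₗ[k] V)) [] := by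
    rwa [← h.eq]
  obtain ⟨s, -⟩ := exists_detIso ha hx 1
  obtain ⟨t, -⟩ := exists_detIso ha hz 1
  have e := commutatorPairing_coeff h s t ha hx hz hy hy'
  rw [s.coeff_congr (map_symm_eq hτ) rfl rfl _ ha _ hx,
    t.coeff_congr (map_symm_eq hσ) rfl rfl _ ha _ hz, mul_comm (s.coeff ha hx)] at e
  exact mul_eq_right.1 e

/-! ### Formal properties of the tame symbol -/

theorem tameSymbol_congr {A : Submodule k V} {σ σ' τ τ' : GLComm A} (hσ : σ = σ') (hτ : τ = τ')
    (h : Commute σ τ) (h' : Commute σ' τ') : tameSymbol A σ τ h = tameSymbol A σ' τ' h' := by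
  subst hσ hτ; rfl

/-- The commutator is multiplicative by centrality, the sign because the index is additive. -/
theorem tameSymbol_mul_left {A : Submodule k V} {σ σ' τ : GLComm A} (h : Commute σ τ)
    (h' : Commute σ' τ) : tameSymbol A (σ * σ') τ (h.mul_left h') =
      tameSymbol A σ τ h * tameSymbol A σ' τ h' := by
  rw [tameSymbol, tameSymbol, tameSymbol, commutatorPairing_mul_left h h', index_mul, add_mul,
    zpow_add]
  exact mul_mul_mul_comm _ _ _ _

theorem tameSymbol_symm {A : Submodule k V} {σ τ : GLComm A} (h : Commute σ τ) :
    tameSymbol A τ σ h.symm = (tameSymbol A σ τ h)⁻¹ := by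
  rw [tameSymbol, tameSymbol, commutatorPairing_symm h, mul_inv, ← inv_zpow, inv_neg_one,
    mul_comm (index A (τ : V ≃ₗ[k] V))]

theorem tameSymbol_mul_right {A : Submodule k V} {σ τ τ' : GLComm A} (h : Commute σ τ)
    (h' : Commute σ τ') : tameSymbol A σ (τ * τ') (h.mul_right h') =
      tameSymbol A σ τ h * tameSymbol A σ τ' h' := by
  rw [← inv_inj, ← tameSymbol_symm, tameSymbol_mul_left h.symm h'.symm, tameSymbol_symm h,
    tameSymbol_symm h', mul_inv]

theorem tameSymbol_eq_one {A : Submodule k V} {σ τ : GLComm A} (h : Commute σ τ)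
    (hσ : A.map ((σ : V ≃ₗ[k] V) : V →ₗ[k] V) = A) (hτ : A.map ((τ : V ≃ₗ[k] V) : V →ₗ[k] V) = A) :
    tameSymbol A σ τ h = 1 := by
  rw [tameSymbol, commutatorPairing_eq_one h hσ hτ, index_eq_zero hσ]; simp

/-! ### Frames in direct sums -/

section Sup

variable {U : Type*} [AddCommGroup U] [Module k U]

theorem IsFrame.mem {N X : Submodule k V} {x : List V} (h : IsFrame N X x) {v : V} (hv : v ∈ x) :
    v ∈ X :=
  h.sup_span ▸ (le_sup_right (a := N) (subset_span hv))

/-- Since `f X` meets `C` trivially, `(f X + C) / (f N + C)` is a copy of `X / N`. -/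
theorem IsFrame.map_sup {f : U →ₗ[k] V} (hf : Function.Injective f) {C : Submodule k V}
    {N X : Submodule k U} {x : List U} (h : IsFrame N X x) (hC : Disjoint (X.map f) C) :
    IsFrame (N.map f ⊔ C) (X.map f ⊔ C) (x.map f) := by
  induction x generalizing N with
  | nil => rw [isFrame_nil] at h; subst h; exact isFrame_nil.2 rfl
  | cons v l ih =>
    have hv : f v ∈ X.map f := ⟨v, h.mem (by simp), rfl⟩
    have hNX : N.map f ≤ X.map f := Submodule.map_mono h.le
    rw [isFrame_cons] at h
    rw [List.map_cons, isFrame_cons]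
    refine ⟨fun hc => ?_, ?_⟩
    · obtain ⟨n, hn, c, hc, e⟩ := Submodule.mem_sup.1 hc
      -- The component `c = f v - n` in `C` also lies in `f X`, hence vanishes.
      have hcX : c ∈ X.map f := by
        rw [← add_sub_cancel_left n c, e]; exact sub_mem hv (hNX hn)
      rw [Submodule.disjoint_def.1 hC c hcX hc, add_zero] at e
      obtain ⟨m, hm, rfl⟩ := hn
      exact h.1 (hf e ▸ hm)
    · have := ih h.2
      rwa [Submodule.map_sup, Submodule.map_span, Set.image_singleton, sup_right_comm] at this

theorem IsFrame.sup {N X C : Submodule k V} {x : List V} (h : IsFrame N X x)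
    (hC : Disjoint X C) : IsFrame (N ⊔ C) (X ⊔ C) x := by
  have := h.map_sup (f := LinearMap.id) Function.injective_id (C := C) (by rwa [Submodule.map_id])
  simpa [Submodule.map_id] using this

/-- The frame follows the chain `M + N ≤ X + N ≤ X + Y`. -/
theorem IsFrame.sup_append {M N X Y : Submodule k V} {x y : List V} (hx : IsFrame M X x)
    (hy : IsFrame N Y y) (h : Disjoint X Y) : IsFrame (M ⊔ N) (X ⊔ Y) (x ++ y) := by
  refine (hx.sup (h.mono_right hy.le)).append ?_
  rw [sup_comm X, sup_comm X]
  exact hy.sup h.symm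

/-- The map `U / N → V / (f N + C)` induced by `f` carries one wedge product to the other, by
functoriality of the exterior algebra. -/
theorem wedge_map_sup (f : U →ₗ[k] V) (C : Submodule k V) {N : Submodule k U} {x y : List U}
    {α : kˣ} (h : wedge N x = α • wedge N y) :
    wedge (N.map f ⊔ C) (x.map f) = α • wedge (N.map f ⊔ C) (y.map f) := by
  let g : (U ⧸ N) →ₗ[k] V ⧸ (N.map f ⊔ C) :=
    N.mapQ _ f (Submodule.map_le_iff_le_comap.1 le_sup_left)
  have key : ∀ x : List U, wedge (N.map f ⊔ C) (x.map f) = ExteriorAlgebra.map g (wedge N x) := by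
    intro x
    simp only [wedge, List.map_map, map_list_prod]
    congr 2
    funext v
    simp [g]
  rw [key, key, h]
  simp [Units.smul_def]

/-! ### Cancelling a common invariant summand -/

theorem IsFrame.map_sup_eq {f : U →ₗ[k] V} (hf : Function.Injective f) {C : Submodule k V}
    (hC : Disjoint (LinearMap.range f) C) {N X : Submodule k U} {X' : Submodule k V} {x : List U}
    (hX : X.map f ⊔ C = X') (h : IsFrame N X x) : IsFrame (N.map f ⊔ C) X' (x.map f) :=
  hX ▸ h.map_sup hf (hC.mono_left LinearMap.map_le_range)

/-- The isomorphism `(f X ⊕ C | f Y ⊕ C) → (X | Y)` for an injective `f`. -/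
def DetIso.cancel {f : U →ₗ[k] V} (hf : Function.Injective f) {C : Submodule k V}
    (hC : Disjoint (LinearMap.range f) C) {X Y : Submodule k U} {X' Y' : Submodule k V}
    (c : DetIso X' Y') (hX : X.map f ⊔ C = X') (hY : Y.map f ⊔ C = Y') : DetIso X Y where
  coeff hx hy := c.coeff (hx.map_sup_eq hf hC hX) (hy.map_sup_eq hf hC hY)
  basis_change hx hx' hy hy' α β hα hβ :=
    c.basis_change _ _ _ _ α β (wedge_map_sup f C hα) (wedge_map_sup f C hβ)
  shrink {M N w x y} hw hx hy := by
    simp only [List.map_append]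
    exact c.shrink (hw.map_sup_eq hf hC rfl) (hx.map_sup_eq hf hC hX) (hy.map_sup_eq hf hC hY)

theorem map_map_sup {f : U →ₗ[k] V} {C : Submodule k V} {X : Submodule k U} {σ : V ≃ₗ[k] V}
    {σ' : U ≃ₗ[k] U} (hσC : C.map (σ : V →ₗ[k] V) = C) (hσ : ∀ u, σ (f u) = f (σ' u)) :
    (X.map f ⊔ C).map (σ : V →ₗ[k] V) = (X.map (σ' : U →ₗ[k] U)).map f ⊔ C := by
  rw [Submodule.map_sup, hσC, ← Submodule.map_comp, ← Submodule.map_comp]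
  congr 2
  ext u
  exact hσ u

/-- The tame symbol of an invariant subspace that contains `A` up to a complement on which both
automorphisms act with invariant lattice. -/
theorem tameSymbol_cancel {f : U →ₗ[k] V} (hf : Function.Injective f) {C : Submodule k V}
    (hC : Disjoint (LinearMap.range f) C) {A' : Submodule k U} {A : Submodule k V}
    (hA : A'.map f ⊔ C = A) {σ τ : GLComm A} {σ' τ' : GLComm A'} (h : Commute σ τ)
    (h' : Commute σ' τ') (hσC : C.map ((σ : V ≃ₗ[k] V) : V →ₗ[k] V) = C)
    (hτC : C.map ((τ : V ≃ₗ[k] V) : V →ₗ[k] V) = C)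
    (hσ : ∀ u, (σ : V ≃ₗ[k] V) (f u) = f ((σ' : U ≃ₗ[k] U) u))
    (hτ : ∀ u, (τ : V ≃ₗ[k] V) (f u) = f ((τ' : U ≃ₗ[k] U) u)) :
    tameSymbol A σ τ h = tameSymbol A' σ' τ' h' := by
  subst hA
  have hd : ∀ X : Submodule k U, Disjoint (X.map f) C := fun X =>
    hC.mono_left LinearMap.map_le_range
  have eσ : (A'.map ((σ' : U ≃ₗ[k] U) : U →ₗ[k] U)).map f ⊔ C =
    (A'.map f ⊔ C).map ((σ : V ≃ₗ[k] V) : V →ₗ[k] V) := (map_map_sup hσC hσ).symm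
  have eτ : (A'.map ((τ' : U ≃ₗ[k] U) : U →ₗ[k] U)).map f ⊔ C =
    (A'.map f ⊔ C).map ((τ : V ≃ₗ[k] V) : V →ₗ[k] V) := (map_map_sup hτC hτ).symm
  have eστ : (A'.map (((σ' * τ' : GLComm A') : U ≃ₗ[k] U) : U →ₗ[k] U)).map f ⊔ C =
      (A'.map f ⊔ C).map (((σ * τ : GLComm (A'.map f ⊔ C)) : V ≃ₗ[k] V) : V →ₗ[k] V) := by
    rw [← DetExt.map_mul, ← DetExt.map_mul, ← eτ, map_map_sup hσC hσ]
  have eτσ : (A'.map (((τ' * σ' : GLComm A') : U ≃ₗ[k] U) : U →ₗ[k] U)).map f ⊔ C =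
      (A'.map f ⊔ C).map (((τ * σ : GLComm (A'.map f ⊔ C)) : V ≃ₗ[k] V) : V →ₗ[k] V) := by
    rw [← h.eq, ← h'.eq]; exact eστ
  have hsymm : ∀ {ρ : V ≃ₗ[k] V} {ρ' : U ≃ₗ[k] U} (hρ : ∀ u, ρ (f u) = f (ρ' u)) (u : U),
      ρ.symm (f u) = f (ρ'.symm u) := by
    intro ρ ρ' hρ u
    rw [LinearEquiv.symm_apply_eq, hρ, LinearEquiv.apply_symm_apply]
  have hlist : ∀ {ρ : V ≃ₗ[k] V} {ρ' : U ≃ₗ[k] U} (hρ : ∀ u, ρ (f u) = f (ρ' u)) (l : List U),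
      (l.map f).map ρ.symm = (l.map ρ'.symm).map f := by
    intro ρ ρ' hρ l
    rw [List.map_map, List.map_map]
    exact List.map_congr_left fun u _ => hsymm hρ u
  obtain ⟨N, ⟨a, ha⟩, hN⟩ := DetExt.exists_frames [σ', τ', σ' * τ']
  obtain ⟨x, hx⟩ := hN σ' (by simp)
  obtain ⟨z, hz⟩ := hN τ' (by simp)
  obtain ⟨y, hy⟩ := hN (σ' * τ') (by simp)
  have hy' : IsFrame N (A'.map (((τ' * σ' : GLComm A') : U ≃ₗ[k] U) : U →ₗ[k] U)) y := by
    rwa [← h'.eq]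
  have ga := ha.map_sup hf (hd _)
  have gx := eσ ▸ hx.map_sup hf (hd _)
  have gz := eτ ▸ hz.map_sup hf (hd _)
  have gy := eστ ▸ hy.map_sup hf (hd _)
  have gy' := eτσ ▸ hy'.map_sup hf (hd _)
  -- Any lifts compute the commutator. The lifts on `U` are taken to be the cancelled forms of those
  -- on `V`, so that both commutators are expressed by the same coefficients.
  obtain ⟨s, -⟩ := exists_detIso ga gx 1
  obtain ⟨t, -⟩ := exists_detIso ga gz 1
  have e := commutatorPairing_coeff h s t ga gx gz gy gy'
  have e' := commutatorPairing_coeff h' (s.cancel hf hC rfl eσ) (t.cancel hf hC rfl eτ) ha hx hz hy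
    hy'
  have i1 : index (A'.map f ⊔ C) (σ : V ≃ₗ[k] V) = index A' (σ' : U ≃ₗ[k] U) := by
    rw [index_eq ga gx, index_eq ha hx]; simp
  have i2 : index (A'.map f ⊔ C) (τ : V ≃ₗ[k] V) = index A' (τ' : U ≃ₗ[k] U) := by
    rw [index_eq ga gz, index_eq ha hz]; simp
  rw [tameSymbol, tameSymbol, i1, i2]
  congr 1
  -- Pulling `f N + C` and the image frames back by `σ⁻¹` or `τ⁻¹` commutes with `f`, so the two
  -- coefficient identities agree factor by factor.
  refine mul_right_cancel (e.trans ?_)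
  refine Eq.trans ?_ (e'.symm.trans ?_)
  · simp only [DetIso.cancel]
    congr 1
    exact t.coeff_congr (map_map_sup (map_symm_eq hσC) (hsymm hσ)) (hlist hσ x) (hlist hσ y) _ _ _ _
  · simp only [DetIso.cancel]
    congr 2
    exact (s.coeff_congr (map_map_sup (map_symm_eq hτC) (hsymm hτ)) (hlist hτ z) (hlist hτ y)
      _ _ _ _).symm

end Sup

/-! ### Automorphisms supported on independent subspaces -/

/-- A common initial segment is removed by `shrink` alone, with no sign. -/
theorem DetIso.coeff_append_left {X Y M N B : Submodule k V} {b c d : List V} (t : DetIso X Y)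
    (hb : IsFrame M B b) (h : Disjoint B N) (hx : IsFrame (M ⊔ N) X (b ++ c))
    (hy : IsFrame (M ⊔ N) Y (b ++ d)) (hx' : IsFrame (B ⊔ N) X c) (hy' : IsFrame (B ⊔ N) Y d) :
    t.coeff hx hy = t.coeff hx' hy' :=
  t.shrink (hb.sup h) hx' hy'

/-- A common final segment has to be moved to the front of both frames before `shrink` applies. The
two exchange signs cancel only up to the difference of the lengths of `b` and `d`. -/
theorem DetIso.coeff_append_right {X Y M N C : Submodule k V} {b c d : List V} (s : DetIso X Y)
    (hc : IsFrame N C c) (h : Disjoint M C) (hx : IsFrame (M ⊔ N) X (b ++ c))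
    (hy : IsFrame (M ⊔ N) Y (d ++ c)) (hx' : IsFrame (M ⊔ C) X b) (hy' : IsFrame (M ⊔ C) Y d) :
    s.coeff hx hy = (-1) ^ ((d.length - b.length : ℤ) * c.length) * s.coeff hx' hy' := by
  have hc' : IsFrame (M ⊔ N) (M ⊔ C) c := by
    rw [sup_comm M, sup_comm M]; exact hc.sup h.symm
  have e := s.basis_change (hc'.append hx') hx (hc'.append hy') hy _ _ (wedge_swap _ _ _)
    (wedge_swap _ _ _)
  rw [s.shrink hc' hx' hy', ← zpow_natCast, ← zpow_natCast, ← eq_inv_mul_iff_mul_eq, ← mul_assoc,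
    ← zpow_neg, ← zpow_add] at e
  rw [e]
  congr 2
  push_cast
  ring

/-- Here `σ` moves only the summand `B` and `τ` only `C`. The value of `s` depends on `B` and `σ B`,
that of `t` on `C` and `τ C`, apart from the sign for carrying along the other summand. Since `τ`
changes the relative dimension of `C`, the two values of `s` differ by a sign, which cancels the one
in the tame symbol. -/
theorem tameSymbol_eq_one_of_disjoint {P Q A B C : Submodule k V} (hPQ : Disjoint P Q) (hB : B ≤ P)
    (hC : C ≤ Q) (hA : B ⊔ C = A) {σ τ : GLComm A} (h : Commute σ τ)
    (hσP : ∀ p ∈ P, (σ : V ≃ₗ[k] V) p ∈ P) (hσQ : ∀ q ∈ Q, (σ : V ≃ₗ[k] V) q = q)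
    (hτP : ∀ p ∈ P, (τ : V ≃ₗ[k] V) p = p) (hτQ : ∀ q ∈ Q, (τ : V ≃ₗ[k] V) q ∈ Q) :
    tameSymbol A σ τ h = 1 := by
  have hfix : ∀ {ρ : V ≃ₗ[k] V} {X : Submodule k V}, (∀ v ∈ X, ρ v = v) →
      X.map (ρ : V →ₗ[k] V) = X := by
    intro ρ X hρ
    ext v
    exact ⟨by rintro ⟨w, hw, rfl⟩; exact (hρ w hw).symm ▸ hw, fun hv => ⟨v, hv, hρ v hv⟩⟩
  have hfix' : ∀ {ρ : V ≃ₗ[k] V} {v : V}, ρ v = v → ρ.symm v = v := by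
    intro ρ v hv
    rw [LinearEquiv.symm_apply_eq, hv]
  have hlist : ∀ {ρ : V ≃ₗ[k] V} {l : List V}, (∀ v ∈ l, ρ v = v) → l.map ρ.symm = l := by
    intro ρ l hl
    exact (List.map_congr_left fun v hv => hfix' (hl v hv)).trans (List.map_id l)
  set B₁ := B.map ((σ : V ≃ₗ[k] V) : V →ₗ[k] V)
  set C₁ := C.map ((τ : V ≃ₗ[k] V) : V →ₗ[k] V)
  have hB₁ : B₁ ≤ P := by rintro _ ⟨b, hb, rfl⟩; exact hσP b (hB hb)
  have hC₁ : C₁ ≤ Q := by rintro _ ⟨c, hc, rfl⟩; exact hτQ c (hC hc)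
  have hAmap : ∀ ρ : V ≃ₗ[k] V, A.map (ρ : V →ₗ[k] V) =
      B.map (ρ : V →ₗ[k] V) ⊔ C.map (ρ : V →ₗ[k] V) := by
    intro ρ; rw [← hA, Submodule.map_sup]
  have eσ : B₁ ⊔ C = A.map ((σ : V ≃ₗ[k] V) : V →ₗ[k] V) := by
    rw [hAmap, hfix fun v hv => hσQ v (hC hv)]
  have eτ : B ⊔ C₁ = A.map ((τ : V ≃ₗ[k] V) : V →ₗ[k] V) := by
    rw [hAmap, hfix fun v hv => hτP v (hB hv)]
  have eστ : B₁ ⊔ C₁ = A.map (((σ * τ : GLComm A) : V ≃ₗ[k] V) : V →ₗ[k] V) := by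
    rw [← DetExt.map_mul, ← eτ, Submodule.map_sup, hfix fun v hv => hσQ v (hC₁ hv)]
  have eτσ : B₁ ⊔ C₁ = A.map (((τ * σ : GLComm A) : V ≃ₗ[k] V) : V →ₗ[k] V) := by
    rw [← h.eq]; exact eστ
  -- modular law
  have hmodP : ∀ {X Y : Submodule k V}, X ≤ P → Y ≤ Q → (X ⊔ Y) ⊓ P = X := by
    intro X Y hX hY
    rw [sup_inf_assoc_of_le _ hX, (hPQ.symm.mono_left hY).eq_bot, sup_bot_eq]
  have hmodQ : ∀ {X Y : Submodule k V}, X ≤ P → Y ≤ Q → (X ⊔ Y) ⊓ Q = Y := by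
    intro X Y hX hY
    rw [sup_comm, sup_inf_assoc_of_le _ hY, (hPQ.mono_left hX).eq_bot, sup_bot_eq]
  have hfin : ∀ {X Y : Submodule k V} (R : Submodule k V), FinOver X Y →
      FinOver (X ⊓ R) (Y ⊓ R) := by
    intro X Y R hXY
    have := (hXY.comap R.subtype).map R.subtype
    rwa [Submodule.map_comap_subtype, Submodule.map_comap_subtype, inf_comm R, inf_comm R] at this
  have cσ := commensurable_iff.1 (mem_GLComm.1 σ.2)
  have cτ := commensurable_iff.1 (mem_GLComm.1 τ.2)
  rw [← eσ, ← hA] at cσ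
  rw [← eτ, ← hA] at cτ
  -- Intersecting with `P` and with `Q` turns the commensurability of `A` with `σ A` and `τ A` into
  -- that of `B` with `B₁` and of `C` with `C₁`.
  have fB := hfin P cσ.2
  have fB₁ := hfin P cσ.1
  have fC := hfin Q cτ.2
  have fC₁ := hfin Q cτ.1
  rw [hmodP hB hC, hmodP hB₁ hC] at fB fB₁
  rw [hmodQ hB hC, hmodQ hB hC₁] at fC fC₁
  obtain ⟨b, hb⟩ := exists_isFrame inf_le_left ((finOver_of_le le_rfl).inf fB)
  obtain ⟨b₁, hb₁⟩ := exists_isFrame inf_le_right (fB₁.inf (finOver_of_le le_rfl))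
  obtain ⟨c, hc⟩ := exists_isFrame inf_le_left ((finOver_of_le le_rfl).inf fC)
  obtain ⟨c₁, hc₁⟩ := exists_isFrame inf_le_right (fC₁.inf (finOver_of_le le_rfl))
  -- All four lattices get frames relative to the same `N`, with the part in `P` always before the
  -- part in `Q`.
  have ha : IsFrame (B ⊓ B₁ ⊔ C ⊓ C₁) A (b ++ c) := hA ▸ hb.sup_append hc (hPQ.mono hB hC)
  have hx := eσ ▸ hb₁.sup_append hc (hPQ.mono hB₁ hC)
  have hz := eτ ▸ hb.sup_append hc₁ (hPQ.mono hB hC₁)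
  have hy := eστ ▸ hb₁.sup_append hc₁ (hPQ.mono hB₁ hC₁)
  have hy' := eτσ ▸ hb₁.sup_append hc₁ (hPQ.mono hB₁ hC₁)
  obtain ⟨s, -⟩ := exists_detIso ha hx 1
  obtain ⟨t, -⟩ := exists_detIso ha hz 1
  have e := commutatorPairing_coeff h s t ha hx hz hy hy'
  have lσ : ∀ d : List V, (∀ v ∈ d, v ∈ Q) →
      (b₁ ++ d).map (σ : V ≃ₗ[k] V).symm = b₁.map (σ : V ≃ₗ[k] V).symm ++ d := by
    intro d hd
    rw [List.map_append, hlist fun v hv => hσQ v (hd v hv)]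
  have lτ : ∀ d : List V, (∀ v ∈ d, v ∈ P) →
      (d ++ c₁).map (τ : V ≃ₗ[k] V).symm = d ++ c₁.map (τ : V ≃ₗ[k] V).symm := by
    intro d hd
    rw [List.map_append, hlist fun v hv => hτP v (hd v hv)]
  have nσ : (B ⊓ B₁ ⊔ C ⊓ C₁).map ((σ : V ≃ₗ[k] V).symm : V →ₗ[k] V) =
      (B ⊓ B₁).map ((σ : V ≃ₗ[k] V).symm : V →ₗ[k] V) ⊔ C ⊓ C₁ := by
    rw [Submodule.map_sup, hfix (X := C ⊓ C₁) (ρ := (σ : V ≃ₗ[k] V).symm) fun v hv => hfix' (hσQ v (hC hv.1))]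
  have nτ : (B ⊓ B₁ ⊔ C ⊓ C₁).map ((τ : V ≃ₗ[k] V).symm : V →ₗ[k] V) =
      B ⊓ B₁ ⊔ (C ⊓ C₁).map ((τ : V ≃ₗ[k] V).symm : V →ₗ[k] V) := by
    rw [Submodule.map_sup, hfix (X := B ⊓ B₁) (ρ := (τ : V ≃ₗ[k] V).symm) fun v hv => hfix' (hτP v (hB hv.1))]
  have pσ : IsFrame ((B ⊓ B₁).map ((σ : V ≃ₗ[k] V).symm : V →ₗ[k] V)) B
      (b₁.map (σ : V ≃ₗ[k] V).symm) := hb₁.pullback _ rfl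
  have pτ : IsFrame ((C ⊓ C₁).map ((τ : V ≃ₗ[k] V).symm : V →ₗ[k] V)) C
      (c₁.map (τ : V ≃ₗ[k] V).symm) := hc₁.pullback _ rfl
  -- The reduced frames: `t` is compared relative to `B ⊔ C ⊓ C₁` and `s` relative to `B ⊓ B₁ ⊔ C`.
  -- They no longer involve `σ⁻¹` or `τ⁻¹`, so both occurrences of `t`, and up to sign both of `s`,
  -- reduce to the same value.
  have gc : IsFrame (B ⊔ C ⊓ C₁) A c :=
    hA ▸ (isFrame_nil.2 (rfl : B = B)).sup_append hc (hPQ.mono hB hC)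
  have gc₁ := eτ ▸ (isFrame_nil.2 (rfl : B = B)).sup_append hc₁ (hPQ.mono hB hC₁)
  have gb : IsFrame (B ⊓ B₁ ⊔ C) A (b ++ []) :=
    hA ▸ hb.sup_append (isFrame_nil.2 (rfl : C = C)) (hPQ.mono hB hC)
  have gb₁ := eσ ▸ hb₁.sup_append (isFrame_nil.2 (rfl : C = C)) (hPQ.mono hB₁ hC)
  rw [List.append_nil] at gb gb₁
  rw [List.nil_append] at gc₁
  have qx := DetExt.isFrame_symm_self σ hx
  have qy := DetExt.isFrame_symm σ τ hy
  have qz := DetExt.isFrame_symm_self τ hz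
  have qy' := DetExt.isFrame_symm τ σ hy'
  rw [nσ, lσ c fun v hv => hC (hc.mem hv)] at qx
  rw [nσ, lσ c₁ fun v hv => hC₁ (hc₁.mem hv)] at qy
  rw [nτ, lτ b fun v hv => hB (hb.mem hv)] at qz
  rw [nτ, lτ b₁ fun v hv => hB₁ (hb₁.mem hv)] at qy'
  rw [t.coeff_congr nσ (lσ c fun v hv => hC (hc.mem hv)) (lσ c₁ fun v hv => hC₁ (hc₁.mem hv))
      _ qx _ qy,
    s.coeff_congr nτ (lτ b fun v hv => hB (hb.mem hv)) (lτ b₁ fun v hv => hB₁ (hb₁.mem hv))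
      _ qz _ qy',
    t.coeff_append_left hb (hPQ.mono hB (inf_le_left.trans hC)) ha hz gc gc₁,
    t.coeff_append_left pσ (hPQ.mono hB (inf_le_left.trans hC)) qx qy gc gc₁,
    s.coeff_append_right hc (hPQ.mono (inf_le_left.trans hB) hC) ha hx gb gb₁,
    s.coeff_append_right pτ (hPQ.mono (inf_le_left.trans hB) hC) qz qy' gb gb₁,
    mul_left_comm, mul_comm _ (t.coeff gc gc₁)] at e
  replace e := mul_left_cancel e
  rw [← mul_assoc] at e
  replace e := eq_mul_inv_of_mul_eq (mul_right_cancel e)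
  -- The commutator is now `-1` to the power `(b₁.length - b.length) * (c.length - c₁.length)`. As
  -- `i(σ) = b.length - b₁.length` and `i(τ) = c.length - c₁.length`, this exponent is `-i(σ) i(τ)`,
  -- and the exponents add up to zero already in `ℤ`.
  rw [tameSymbol, e, index_eq ha hx, index_eq ha hz, ← zpow_neg, ← zpow_add, ← zpow_add]
  convert zpow_zero (-1 : kˣ)
  simp only [List.length_append, List.length_map]
  push_cast
  ring

/-! ### Products -/

section Pi

variable {I : Type*} {W : I → Type*} [∀ i, AddCommGroup (W i)] [∀ i, Module k (W i)]

theorem map_piCongrRight (A : ∀ i, Submodule k (W i)) (e : ∀ i, W i ≃ₗ[k] W i) :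
    (Submodule.pi Set.univ A).map (LinearEquiv.piCongrRight e : (∀ i, W i) →ₗ[k] ∀ i, W i) =
      Submodule.pi Set.univ fun i => (A i).map (e i : W i →ₗ[k] W i) := by
  ext x
  constructor
  · rintro ⟨y, hy, rfl⟩ i hi
    exact ⟨y i, hy i hi, rfl⟩
  · intro hx
    choose y hy e' using fun i => hx i trivial
    exact ⟨y, fun i _ => hy i, funext e'⟩

/-- The families of automorphisms in `GL(W i, A i)`, almost all of which preserve `A i`. -/
def piGL (A : ∀ i, Submodule k (W i)) : Subgroup (∀ i, GLComm (A i)) where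
  carrier := {g | {i | (A i).map ((g i : W i ≃ₗ[k] W i) : W i →ₗ[k] W i) ≠ A i}.Finite}
  one_mem' := by
    refine Set.finite_empty.subset fun i hi => ?_
    exact hi DetExt.map_one
  mul_mem' {g h} hg hh := by
    refine (hg.union hh).subset fun i hi => ?_
    by_contra hc
    simp only [Set.mem_union, Set.mem_ofPred_eq, not_or, not_not] at hc
    apply hi
    rw [Pi.mul_apply, ← DetExt.map_mul, hc.2, hc.1]
  inv_mem' {g} hg := hg.subset fun i hi hc => hi (map_symm_eq hc)

variable {A : ∀ i, Submodule k (W i)}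

/-- The diagonal action of `piGL A` on the product. -/
def piGLHom (A : ∀ i, Submodule k (W i)) : piGL A →* GLComm (Submodule.pi Set.univ A) where
  toFun g := ⟨LinearEquiv.piCongrRight fun i => (g.1 i : W i ≃ₗ[k] W i), by
    rw [mem_GLComm, map_piCongrRight, commensurable_iff]
    have h := fun i => commensurable_iff.1 (mem_GLComm.1 (g.1 i).2)
    refine ⟨FinOver.pi (fun i => (h i).1) (g.2.subset ?_),
      FinOver.pi (fun i => (h i).2) (g.2.subset ?_)⟩
    · intro i hi hc
      exact hi hc.le
    · intro i hi hc
      exact hi hc.ge⟩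
  map_one' := rfl
  map_mul' _ _ := rfl

theorem piGLHom_map_eq {g : piGL A}
    (hg : ∀ i, (A i).map ((g.1 i : W i ≃ₗ[k] W i) : W i →ₗ[k] W i) = A i) :
    (Submodule.pi Set.univ A).map
      ((piGLHom A g : (∀ i, W i) ≃ₗ[k] ∀ i, W i) : (∀ i, W i) →ₗ[k] ∀ i, W i) =
      Submodule.pi Set.univ A :=
  (map_piCongrRight A _).trans (congrArg _ (funext hg))

/-! ### Families supported at one index -/

variable [DecidableEq I]

/-- The family with a single nontrivial member. -/
def piGLSingle (j : I) (g : GLComm (A j)) : piGL A :=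
  ⟨Pi.mulSingle j g, (Set.finite_singleton j).subset fun i hi => by
    by_contra hij
    exact hi (by rw [Pi.mulSingle_eq_of_ne hij]; exact DetExt.map_one)⟩

theorem Commute.piGLSingle {j : I} {x : GLComm (A j)} {h : piGL A} (hc : Commute x (h.1 j)) :
    Commute (piGLSingle j x) h := by
  refine Subtype.ext (funext fun i => ?_)
  by_cases hij : i = j
  · subst hij
    simpa [Tame.piGLSingle] using hc.eq
  · simp [Tame.piGLSingle, Pi.mulSingle_eq_of_ne hij]

theorem disjoint_range_single_ker_proj (j : I) :
    Disjoint (LinearMap.range (LinearMap.single k W j))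
      (LinearMap.ker (LinearMap.proj (R := k) (φ := W) j)) := by
  rw [Submodule.disjoint_def]
  rintro _ ⟨x, rfl⟩ hx
  have : x = 0 := by simpa using hx
  simp [this]

/-- The product lattice splits along the decomposition of the whole product into the factor `j` and
the families vanishing at `j`. This is the splitting used for cancellation and for disjoint
supports. -/
theorem map_single_sup_ker_proj (A : ∀ i, Submodule k (W i)) (j : I) :
    (A j).map (LinearMap.single k W j) ⊔
      Submodule.pi Set.univ A ⊓ LinearMap.ker (LinearMap.proj (R := k) (φ := W) j) =
      Submodule.pi Set.univ A := by
  have hs : (A j).map (LinearMap.single k W j) ≤ Submodule.pi Set.univ A := by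
    rintro _ ⟨x, hx, rfl⟩ i -
    by_cases hij : i = j
    · subst hij; simpa using hx
    · simp [Pi.single_eq_of_ne hij]
  refine le_antisymm (sup_le hs inf_le_left) fun x hx => ?_
  refine Submodule.mem_sup.2 ⟨LinearMap.single k W j (x j), ⟨x j, hx j trivial, rfl⟩,
    x - LinearMap.single k W j (x j), ⟨sub_mem hx (hs ⟨x j, hx j trivial, rfl⟩), ?_⟩, by simp⟩
  simp

theorem piGLHom_single_apply (g : piGL A) (j : I) (x : W j) :
    (piGLHom A g : (∀ i, W i) ≃ₗ[k] ∀ i, W i) (LinearMap.single k W j x) =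
      LinearMap.single k W j ((g.1 j : W j ≃ₗ[k] W j) x) := by
  ext i
  change (g.1 i : W i ≃ₗ[k] W i) (Pi.single j x i) = Pi.single j ((g.1 j : W j ≃ₗ[k] W j) x) i
  by_cases hij : i = j
  · subst hij; simp
  · simp [Pi.single_eq_of_ne hij]

theorem piGLHom_single_eq_self {j : I} (g : GLComm (A j)) {x : ∀ i, W i} (hx : x j = 0) :
    (piGLHom A (piGLSingle j g) : (∀ i, W i) ≃ₗ[k] ∀ i, W i) x = x := by
  ext i
  change (((Pi.mulSingle j g : ∀ i, GLComm (A i)) i : GLComm (A i)) : W i ≃ₗ[k] W i) (x i) = x i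
  by_cases hij : i = j
  · subst hij; simp [hx]
  · rw [Pi.mulSingle_eq_of_ne hij]; rfl

/-- The supports are complementary: `P` is the factor `j`, and `Q` the kernel of the projection to
it. -/
theorem tameSymbol_piGLSingle_eq_one {j : I} (x : GLComm (A j)) {h : piGL A} (hj : h.1 j = 1)
    (hc : Commute (piGLHom A (piGLSingle j x)) (piGLHom A h)) :
    tameSymbol (Submodule.pi Set.univ A) (piGLHom A (piGLSingle j x)) (piGLHom A h) hc = 1 := by
  refine tameSymbol_eq_one_of_disjoint (disjoint_range_single_ker_proj j) LinearMap.map_le_range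
    inf_le_right (map_single_sup_ker_proj A j) hc ?_ ?_ ?_ ?_
  · rintro _ ⟨p, rfl⟩
    exact ⟨_, (piGLHom_single_apply _ j p).symm⟩
  · exact fun q hq => piGLHom_single_eq_self x hq
  · rintro _ ⟨p, rfl⟩
    rw [piGLHom_single_apply, hj]; rfl
  · intro q hq
    have hq : q j = 0 := hq
    change (h.1 j : W j ≃ₗ[k] W j) (q j) = 0
    rw [hq, map_zero]

/-- The complement `C` consists of the elements of the product lattice vanishing at `j`; both
automorphisms fix it pointwise, so it cancels. -/
theorem tameSymbol_piGLSingle {j : I} {x y : GLComm (A j)} (h : Commute x y)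
    (hc : Commute (piGLHom A (piGLSingle j x)) (piGLHom A (piGLSingle j y))) :
    tameSymbol (Submodule.pi Set.univ A) (piGLHom A (piGLSingle j x)) (piGLHom A (piGLSingle j y))
      hc = tameSymbol (A j) x y h := by
  have hfix : ∀ z : GLComm (A j),
      (Submodule.pi Set.univ A ⊓ LinearMap.ker (LinearMap.proj (R := k) (φ := W) j)).map
        ((piGLHom A (piGLSingle j z) : (∀ i, W i) ≃ₗ[k] ∀ i, W i) : (∀ i, W i) →ₗ[k] ∀ i, W i) =
      Submodule.pi Set.univ A ⊓ LinearMap.ker (LinearMap.proj (R := k) (φ := W) j) := by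
    intro z
    ext v
    constructor
    · rintro ⟨w, hw, rfl⟩
      exact (piGLHom_single_eq_self z hw.2).symm ▸ hw
    · exact fun hv => ⟨v, hv, piGLHom_single_eq_self z hv.2⟩
  have happ : ∀ (z : GLComm (A j)) (u : W j),
      (piGLHom A (piGLSingle j z) : (∀ i, W i) ≃ₗ[k] ∀ i, W i) (LinearMap.single k W j u) =
        LinearMap.single k W j ((z : W j ≃ₗ[k] W j) u) := by
    intro z u
    rw [piGLHom_single_apply]
    simp [piGLSingle]
  exact tameSymbol_cancel (f := LinearMap.single k W j) (Pi.single_injective j)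
    ((disjoint_range_single_ker_proj j).mono_right inf_le_right) (map_single_sup_ker_proj A j) hc h
    (hfix x) (hfix y) (happ x) (happ y)

/-- Induction on a finite set outside which both families preserve the lattices; each step splits
one factor off both families. -/
theorem tameSymbol_pi_eq_prod (J : Finset I) (g h : piGL A) (hc : Commute g h)
    (hi : ∀ i, Commute (g.1 i) (h.1 i))
    (hg : ∀ i ∉ J, (A i).map ((g.1 i : W i ≃ₗ[k] W i) : W i →ₗ[k] W i) = A i)
    (hh : ∀ i ∉ J, (A i).map ((h.1 i : W i ≃ₗ[k] W i) : W i →ₗ[k] W i) = A i) :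
    tameSymbol (Submodule.pi Set.univ A) (piGLHom A g) (piGLHom A h) (hc.map (piGLHom A)) =
      ∏ i ∈ J, tameSymbol (A i) (g.1 i) (h.1 i) (hi i) := by
  induction J using Finset.induction_on generalizing g h with
  | empty =>
    exact tameSymbol_eq_one _ (piGLHom_map_eq fun i => hg i (by simp))
      (piGLHom_map_eq fun i => hh i (by simp))
  | insert j J hj ih =>
    -- `r g` is `g` with its component at `j` replaced by 1. It preserves the lattices outside `J`,
    -- so the induction hypothesis applies to `r g` and `r h`.
    let r : piGL A → piGL A := fun g => g * (piGLSingle j (g.1 j))⁻¹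
    have hr : ∀ g, g = r g * piGLSingle j (g.1 j) := fun g => (inv_mul_cancel_right _ _).symm
    have hrj : ∀ g : piGL A, (r g).1 j = 1 := by
      intro g
      change g.1 j * ((Pi.mulSingle j (g.1 j) : ∀ i, GLComm (A i)) j)⁻¹ = 1
      rw [Pi.mulSingle_eq_same, mul_inv_cancel]
    have hri : ∀ (g : piGL A) {i : I}, i ≠ j → (r g).1 i = g.1 i := by
      intro g i hij
      change g.1 i * ((Pi.mulSingle j (g.1 j) : ∀ i, GLComm (A i)) i)⁻¹ = g.1 i
      rw [Pi.mulSingle_eq_of_ne hij, inv_one, mul_one]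
    have hstab : ∀ g : piGL A, (∀ i ∉ insert j J,
        (A i).map ((g.1 i : W i ≃ₗ[k] W i) : W i →ₗ[k] W i) = A i) →
        ∀ i ∉ J, (A i).map (((r g).1 i : W i ≃ₗ[k] W i) : W i →ₗ[k] W i) = A i := by
      intro g hg i hiJ
      by_cases hij : i = j
      · subst hij
        rw [hrj]; exact DetExt.map_one
      · rw [hri g hij]; exact hg i (by simp [hij, hiJ])
    have cgh : Commute (piGLSingle j (g.1 j)) (piGLSingle j (h.1 j)) :=
      Commute.piGLSingle (by simpa [piGLSingle] using hi j)
    have cgr : Commute (piGLSingle j (g.1 j)) (r h) :=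
      Commute.piGLSingle (by rw [hrj]; exact Commute.one_right _)
    have chr : Commute (piGLSingle j (h.1 j)) (r g) :=
      Commute.piGLSingle (by rw [hrj]; exact Commute.one_right _)
    have crr : Commute (r g) (r h) := by
      refine Subtype.ext (funext fun i => ?_)
      change (r g).1 i * (r h).1 i = (r h).1 i * (r g).1 i
      by_cases hij : i = j
      · subst hij; rw [hrj, hrj]
      · rw [hri _ hij, hri _ hij]; exact hi i
    have hir : ∀ i, Commute ((r g).1 i) ((r h).1 i) := fun i => congrFun (congrArg Subtype.val crr) i
    have eg : piGLHom A g = piGLHom A (r g) * piGLHom A (piGLSingle j (g.1 j)) := by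
      rw [← map_mul, ← hr]
    have eh : piGLHom A h = piGLHom A (r h) * piGLHom A (piGLSingle j (h.1 j)) := by
      rw [← map_mul, ← hr]
    have c1 := crr.map (piGLHom A)
    have c2 := chr.symm.map (piGLHom A)
    have c3 := cgr.map (piGLHom A)
    have c4 := cgh.map (piGLHom A)
    -- Bilinearity gives four symbols. The two mixed ones are 1 by disjointness of supports, one of
    -- them after exchanging its arguments; the pair at `j` gives the local symbol, and the pair `r
    -- g`, `r h` the product over `J`.
    rw [tameSymbol_congr eg eh _ ((c1.mul_right c2).mul_left (c3.mul_right c4)),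
      tameSymbol_mul_left (c1.mul_right c2) (c3.mul_right c4),
      tameSymbol_mul_right c1 c2, tameSymbol_mul_right c3 c4,
      tameSymbol_symm c2.symm, tameSymbol_piGLSingle_eq_one _ (hrj g),
      tameSymbol_piGLSingle_eq_one _ (hrj h), tameSymbol_piGLSingle (hi j), Finset.prod_insert hj,
      ih (r g) (r h) crr hir (hstab g hg) (hstab h hh), inv_one, mul_one, one_mul, mul_comm]
    congr 1
    refine Finset.prod_congr rfl fun i hiJ => ?_
    have hij : i ≠ j := by rintro rfl; exact hj hiJ
    exact tameSymbol_congr (hri g hij) (hri h hij) _ _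

end Pi

/-- The family of the restrictions to the `Ws i`. -/
def componentFamily {V I : Type*} [AddCommGroup V] [Module k V] {Vs Ws : I → Submodule k V}
    (σ : stableGL Vs Ws) : piGL fun i => (Vs i).submoduleOf (Ws i) :=
  ⟨fun i => componentHom Vs Ws i σ, σ.2.1.2.subset fun i hi hc =>
    hi ((restrictEquiv_map (Ws i) (Vs i) σ (σ.2.2 i)).trans (by rw [hc]))⟩

end Tame

/-! ### The product formula -/

theorem mainTheorem5 {k V I : Type*} [Field k] [AddCommGroup V] [Module k V]
    (Vs Ws : I → Submodule k V) (hVW : ∀ i, Vs i ≤ Ws i)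
    (σ τ : Tame.stableGL Vs Ws) (h : Commute σ τ) :
    {i | Tame.tameSymbol ((Vs i).submoduleOf (Ws i)) (Tame.componentHom Vs Ws i σ)
      (Tame.componentHom Vs Ws i τ) (h.map (Tame.componentHom Vs Ws i)) ≠ 1}.Finite ∧
    Tame.tameSymbol (Tame.prodSubmodule Vs Ws) (Tame.diagonalHom Vs Ws σ)
        (Tame.diagonalHom Vs Ws τ) (h.map (Tame.diagonalHom Vs Ws)) =
      ∏ᶠ i, Tame.tameSymbol ((Vs i).submoduleOf (Ws i)) (Tame.componentHom Vs Ws i σ)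
        (Tame.componentHom Vs Ws i τ) (h.map (Tame.componentHom Vs Ws i)) ∧
    (Tame.commutatorPairing (Tame.prodSubmodule Vs Ws) (Tame.diagonalHom Vs Ws σ)
        (Tame.diagonalHom Vs Ws τ) (h.map (Tame.diagonalHom Vs Ws)) = 1 →
      Tame.index (Tame.prodSubmodule Vs Ws)
        (Tame.diagonalHom Vs Ws σ : (∀ i, Ws i) ≃ₗ[k] (∀ i, Ws i)) = 0 →
      ∏ᶠ i, Tame.tameSymbol ((Vs i).submoduleOf (Ws i)) (Tame.componentHom Vs Ws i σ)
        (Tame.componentHom Vs Ws i τ) (h.map (Tame.componentHom Vs Ws i)) = 1) := by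
  classical
  have hfin := (Tame.componentFamily σ).2.union (Tame.componentFamily τ).2
  -- The indices at which `σ` or `τ` moves the lattice. Elsewhere both preserve it and the local
  -- symbol is 1.
  set J := hfin.toFinset with hJ
  have hJ' : ∀ i ∉ J,
      ((Vs i).submoduleOf (Ws i)).map ((Tame.componentHom Vs Ws i σ : Ws i ≃ₗ[k] Ws i) :
        Ws i →ₗ[k] Ws i) = (Vs i).submoduleOf (Ws i) ∧
      ((Vs i).submoduleOf (Ws i)).map ((Tame.componentHom Vs Ws i τ : Ws i ≃ₗ[k] Ws i) :
        Ws i →ₗ[k] Ws i) = (Vs i).submoduleOf (Ws i) := by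
    intro i hi
    rw [hJ, Set.Finite.mem_toFinset, Set.mem_union, not_or] at hi
    exact ⟨not_not.1 hi.1, not_not.1 hi.2⟩
  have hsub : {i | Tame.tameSymbol ((Vs i).submoduleOf (Ws i)) (Tame.componentHom Vs Ws i σ)
      (Tame.componentHom Vs Ws i τ) (h.map (Tame.componentHom Vs Ws i)) ≠ 1} ⊆ (J : Set I) := by
    intro i hi
    by_contra hc
    exact hi (Tame.tameSymbol_eq_one _ (hJ' i hc).1 (hJ' i hc).2)
  have hprod : Tame.tameSymbol (Tame.prodSubmodule Vs Ws) (Tame.diagonalHom Vs Ws σ)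
        (Tame.diagonalHom Vs Ws τ) (h.map (Tame.diagonalHom Vs Ws)) =
      ∏ᶠ i, Tame.tameSymbol ((Vs i).submoduleOf (Ws i)) (Tame.componentHom Vs Ws i σ)
        (Tame.componentHom Vs Ws i τ) (h.map (Tame.componentHom Vs Ws i)) := by
    rw [finprod_eq_prod_of_mulSupport_subset _ hsub]
    -- The diagonal action is by definition the image under `piGLHom` of the family of restrictions.
    exact Tame.tameSymbol_pi_eq_prod J (Tame.componentFamily σ) (Tame.componentFamily τ)
      (Subtype.ext (funext fun i => h.map (Tame.componentHom Vs Ws i)))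
      (fun i => h.map (Tame.componentHom Vs Ws i)) (fun i hi => (hJ' i hi).1)
      (fun i hi => (hJ' i hi).2)
  refine ⟨J.finite_toSet.subset hsub, hprod, fun hc hi => ?_⟩
  -- Vanishing of the index of `σ` alone removes the sign, and the symbol of the product is then the
  -- commutator.
  rw [← hprod, Tame.tameSymbol, hc, hi, zero_mul, zpow_zero, one_mul]
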